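/- **Theorem (Solving declining, respectively improving, temporal reachability games is in P).** A temporal reachability game consists of a finite set of vertices $V=V_1\uplus V_2$ (vertices in $V_i$ belong to Player $i$), a target set $F\subseteq V$, and for all $u,v\in V$ a set $E(u,v)\subseteq\mathbb N$ of times at which the edge from $u$ to $v$ is available. It is played on the infinite expansion with positions $V\times\mathbb N$: at a position $(u,i)$ the owner of $u$ chooses some $v$ with $i\in E(u,v)$, and the play continues at $(v,i+1)$. Player 1 wins a play if it visits $F\times\mathbb N$; a player who has to move but cannot loses, unless $F\times\mathbb N$ has been visited; every other play is won by Player 2. An edge $(u,v)$ is decreasing if $i+1\in E(u,v)$ implies $i\in E(u,v)$ for all $i\in\mathbb N$, and increasing if $i\in E(u,v)$ implies $i+1\in E(u,v)$ for all $i\in\mathbb N$. The game is declining if all edges $(u,v)$ with $u\in V_1$ are decreasing and all edges $(u,v)$ with $u\in V_2$ are increasing; it is improving if the reverse holds, i.e. all edges with $u\in V_1$ are increasing and all edges with $u\in V_2$ are decreasing. Let games be given by a table which for every pair $(u,v)\in V^2$ either says that there is no edge ($E(u,v)=\emptyset$) or gives one constraint $x\le c$ or $x\ge c$ with $c\in\mathbb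 N$ written in binary, meaning $E(u,v)=\{x\in\mathbb N : x\le c\}$, respectively $E(u,v)=\{x\in\mathbb N : x\ge c\}$. Then the following two decision problems are in $\mathsf P$, that is, each is decided by a deterministic Turing machine in time polynomial in the length of the encoding of the input: given such a game and an initial vertex $s$, decide whether the game is declining (respectively improving) and Player 1 has a winning strategy from $(s,0)$. -/

import Mathlib

namespace TemporalGames

/-! ## Reachability games on (possibly infinite) directed graphs -/

/-- A two-player turn-based reachability game with positions `X`.
Positions in `V₁` belong to Player 1, all others belong to Player 2. -/
structure ReachGame (X : Type) where
  edge : X → X → Prop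
  V₁ : Set X
  target : Set X

namespace ReachGame

variable {X : Type} (G : ReachGame X)

/-- A (history dependent) strategy of Player 1: given the list `h` of the positions visited
earlier and the current position `x`, it names the next position, which is a successor
of `x` whenever `x` belongs to Player 1 and has a successor. -/
structure Strategy where
  move : List X → X → X
  legal : ∀ h x, x ∈ G.V₁ → (∃ y, G.edge x y) → G.edge x (move h x)

/-- A play from `x`: a maximal path `pos 0 = x, pos 1, …` with `len ≤ ∞` many moves.
It is infinite (`len = ⊤`) or ends in a position without successors
(the values `pos k` for `k > len` are irrelevant). -/
structure Play (x : X) where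
  len : ℕ∞
  pos : ℕ → X
  start : pos 0 = x
  step : ∀ k : ℕ, (k : ℕ∞) < len → G.edge (pos k) (pos (k + 1))
  maximal : ∀ k : ℕ, (k : ℕ∞) = len → ∀ y, ¬ G.edge (pos k) y

variable {G}

/-- All moves made by Player 1 in the play are those named by the strategy. -/
def Play.Consistent {x : X} (π : G.Play x) (σ : G.Strategy) : Prop :=
  ∀ k : ℕ, (k : ℕ∞) < π.len → π.pos k ∈ G.V₁ →
    π.pos (k + 1) = σ.move ((List.range k).map π.pos) (π.pos k)

/-- Player 1 wins a play if it visits the target, or if it ends in a position where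
Player 2 has to move but cannot. All other plays are won by Player 2. -/
def Play.WonByPlayer1 {x : X} (π : G.Play x) : Prop :=
  (∃ k : ℕ, (k : ℕ∞) ≤ π.len ∧ π.pos k ∈ G.target) ∨
    (∃ k : ℕ, (k : ℕ∞) = π.len ∧ π.pos k ∉ G.V₁)

variable (G)

/-- Player 1 has a winning strategy from `x`. -/
def Player1Wins (x : X) : Prop :=
  ∃ σ : G.Strategy, ∀ π : G.Play x, π.Consistent σ → π.WonByPlayer1

end ReachGame

/-! ## Temporal reachability games -/

/-- A reachability game on a temporal graph with vertices `V`: `avail u v` is the set of times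
at which the edge from `u` to `v` can be traversed. -/
structure TemporalGame (V : Type) where
  avail : V → V → Set ℕ
  V₁ : Set V
  target : Set V

namespace TemporalGame

variable {V : Type} (G : TemporalGame V)

/-- The edge from `u` to `v` can only disappear over time. -/
def DecreasingEdge (u v : V) : Prop := ∀ i : ℕ, i + 1 ∈ G.avail u v → i ∈ G.avail u v

/-- The edge from `u` to `v` can only appear over time. -/
def IncreasingEdge (u v : V) : Prop := ∀ i : ℕ, i ∈ G.avail u v → i + 1 ∈ G.avail u v

/-- Edges of Player 1 are decreasing, edges of Player 2 are increasing. -/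
def Declining : Prop :=
  (∀ u ∈ G.V₁, ∀ v, G.DecreasingEdge u v) ∧ (∀ u ∉ G.V₁, ∀ v, G.IncreasingEdge u v)

/-- Edges of Player 1 are increasing, edges of Player 2 are decreasing. -/
def Improving : Prop :=
  (∀ u ∈ G.V₁, ∀ v, G.IncreasingEdge u v) ∧ (∀ u ∉ G.V₁, ∀ v, G.DecreasingEdge u v)

/-- The reachability game on the infinite expansion `V × ℕ`: being at `u` at time `i`, a move
traverses an edge that is available at time `i` and leads to time `i + 1`. -/
def expansion : ReachGame (V × ℕ) where
  edge p q := q.2 = p.2 + 1 ∧ p.2 ∈ G.avail p.1 q.1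
  V₁ := {p | p.1 ∈ G.V₁}
  target := {p | p.1 ∈ G.target}

/-- Player 1 wins the temporal reachability game from vertex `s` at time `0`. -/
def Player1Wins (s : V) : Prop := G.expansion.Player1Wins (s, 0)

end TemporalGame

/-! ## Finite presentations and their encoding as strings -/

/-- An edge constraint on the time `x`: either `x ≤ c` or `x ≥ c`. -/
inductive Constraint where
  | le (c : ℕ)
  | ge (c : ℕ)

/-- The set of times that satisfy a constraint. -/
def Constraint.times : Constraint → Set ℕ
  | .le c => {x | x ≤ c}
  | .ge c => {x | x ≥ c}

/-- An input of the decision problem: a temporal reachability game with vertices `Fin n`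
and an initial vertex. Every ordered pair of vertices is either not an edge (`none`)
or carries one inequality constraint that says when the edge is available. -/
structure Instance where
  n : ℕ
  ownedBy1 : Fin n → Bool
  isTarget : Fin n → Bool
  init : Fin n
  edge : Fin n → Fin n → Option Constraint

namespace Instance

/-- The temporal reachability game described by an instance. -/
def game (I : Instance) : TemporalGame (Fin I.n) where
  avail u v := {x | ∃ c, I.edge u v = some c ∧ x ∈ c.times}
  V₁ := {v | I.ownedBy1 v = true}
  target := {v | I.isTarget v = true}

open Computability (Γ' encodeNat)

/-- Encoding of an entry of the edge table; the time in a constraint is written in binary. -/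
def encodeEntry : Option Constraint → List Γ'
  | none => []
  | some (.le c) => Γ'.bit false :: (encodeNat c).map Γ'.bit
  | some (.ge c) => Γ'.bit true :: (encodeNat c).map Γ'.bit

/-- Encoding of a vertex: its owner, whether it is a target, whether it is the initial vertex,
and its row of the edge table. -/
def encodeVertex (I : Instance) (v : Fin I.n) : List Γ' :=
  [Γ'.bra, Γ'.bit (I.ownedBy1 v), Γ'.bit (I.isTarget v), Γ'.bit (decide (v = I.init))] ++
    (List.finRange I.n).flatMap (fun w => Γ'.comma :: encodeEntry (I.edge v w)) ++ [Γ'.ket]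

/-- The string that is the input of the decision problem. -/
def encode (I : Instance) : List Γ' := (List.finRange I.n).flatMap I.encodeVertex

end Instance

/-! ## Polynomial time -/

open Classical in
/-- The decision problem `L` on inputs of type `α`, encoded as strings by `enc`, is in `P`: some
deterministic Turing machine decides `L` in time polynomial in the length of the input string. -/
def InP {α Γ : Type} (enc : α → List Γ) (L : α → Prop) : Prop :=
  Nonempty (Turing.TM2ComputableInPolyTime enc Computability.encodeBool (fun a => decide (L a)))

end TemporalGames

/-!
Both problems are decided by value iteration. In a declining game, if Player 1 wins from a vertex at
some time, then also at all earlier times, so that the times at which Player 1 wins are those below a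
value in `ℕ ∪ {∞}`; in an improving game the same holds for the times at which Player 2 wins. In both
cases the player with the decreasing edges wants large values, and a vertex `v` of that player has
the value `max_w min(b(v, w), T(w) - 1)`, where the edge to `w` is available below `b(v, w)`; a
vertex of the other player has the value `min_w max(b(v, w), T(w) - 1)`, where the edge is available
from `b(v, w)` on. Targets have the value `∞` in declining games and `0` in improving games.

In a declining game the values are the least solution of these equations. The iteration from the
table that is `0` everywhere reaches it after as many rounds as there are vertices: an increase in
round `k` is caused by an increase in the round before at a successor, and no vertex can occur twice
on such a chain, because time only moves forward (`iterate_stepSet_stationary`). In an improving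
game the values are the greatest solution, and the iteration from the table that is `∞` everywhere
may take exponentially many rounds. But whether a value is infinite depends only on the edges
that are available forever, and is settled after as many rounds as there are vertices
(`forall_stepSet_iff`, `antitone_stationary`). The second phase replaces all finite values by `0` and
iterates again, now increasingly. Its limit has the right infinite values, and a backward induction
on the time shows that it is correct (`Instance.player1Wins_iff_of_improving`).

Values never need more digits than the input has symbols, so each round takes polynomial time. To
prove this for Turing machines, `Prog` is a structured language of programs on finitely many stacks
over a finite alphabet, with an execution relation that counts steps. `Prog.Exec.simulate` compiles
it to Mathlib's stack machines without loss of time, and `runs_decisionCode` is the correctness and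
running time of the decision procedure as such a program.
-/

namespace TemporalGames

open Computability (Γ' encodeNat)

/-! ### A structured language of stack programs and its compilation to Turing machines -/

/-- Programs that manipulate finitely many stacks, indexed by `R`, over the alphabet `A`.
Control depends on the data only through the symbol on top of a stack
(`none` for the empty stack). -/
inductive Prog (R A : Type) where
  | skip
  | push (r : R) (a : A)
  | seq (p q : Prog R A)
  /-- Remove the top symbol of `r` and continue with a program that depends on it. -/
  | pop (r : R) (f : Option A → Prog R A)
  /-- While the top symbol of `r` does not satisfy `halts`: remove it and run a program that
  depends on it. -/
  | loop (r : R) (halts : Option A → Bool) (f : Option A → Prog R A)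

namespace Prog

open Turing

variable {R A : Type}

section Exec

variable [DecidableEq R]

/-- `Exec p s s' n`: the program `p` terminates on the stack contents `s`, with the contents `s'`,
and costs `n` steps. -/
inductive Exec : Prog R A → (R → List A) → (R → List A) → ℕ → Prop
  | skip (s) : Exec skip s s 1
  | push (r a s) : Exec (push r a) s (Function.update s r (a :: s r)) 1
  | seq {p q s s' s'' m n} : Exec p s s' m → Exec q s' s'' n → Exec (seq p q) s s'' (n + m)
  | pop {r f s s' n} : Exec (f (s r).head?) (Function.update s r (s r).tail) s' n →
      Exec (pop r f) s s' (n + 1)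
  | halts {r halts f s} : halts (s r).head? = true → Exec (loop r halts f) s s 1
  | step {r halts f s s' s'' m n} : halts (s r).head? = false →
      Exec (f (s r).head?) (Function.update s r (s r).tail) s' m →
      Exec (loop r halts f) s' s'' n → Exec (loop r halts f) s s'' (n + (m + 1))

end Exec

/-- The control points of a program. -/
def Label : Prog R A → Type
  | skip => Unit
  | push _ _ => Unit
  | seq p q => Label p ⊕ Label q
  | pop _ f => Option (Σ o, Label (f o))
  | loop _ _ f => Option (Σ o, Label (f o))

/-- The control point at which the execution of a program begins. -/
def entry : (p : Prog R A) → Label p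
  | skip => ()
  | push _ _ => ()
  | seq p _ => .inl (entry p)
  | pop _ _ => none
  | loop _ _ _ => none

theorem finite_label [Finite A] (p : Prog R A) : Finite (Label p) := by
  induction p with
  | skip => exact inferInstanceAs (Finite Unit)
  | push => exact inferInstanceAs (Finite Unit)
  | seq p q ihp ihq => exact inferInstanceAs (Finite (Label p ⊕ Label q))
  | pop r f ih => exact inferInstanceAs (Finite (Option (Σ o, Label (f o))))
  | loop r halts f ih => exact inferInstanceAs (Finite (Option (Σ o, Label (f o))))

/-- The stack alphabets of the compiled machine: the stacks of the program, and one more stack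
that holds the Boolean answer. -/
abbrev StackAlphabet (R A : Type) (k : Option R) : Type :=
  match k with
  | none => Bool
  | some _ => A

/-- The statement executed at a control point of `p`. The labels of `p` are embedded into the
labels `Λ` of a larger machine by `emb`, and `exit` is the label at which that machine continues
after `p`. The internal state of the machine is the symbol read last. -/
def compile {Λ : Type} : (p : Prog R A) → (Label p → Λ) → Λ → Label p →
    TM2.Stmt (StackAlphabet R A) Λ (Option A)
  | skip, _, exit, _ => .goto fun _ => exit
  | push r a, _, exit, _ => .push (some r) (fun _ => a) (.goto fun _ => exit)
  | seq p q, emb, _, .inl l => compile p (emb ∘ .inl) (emb (.inr (entry q))) l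
  | seq _ q, emb, exit, .inr l => compile q (emb ∘ .inr) exit l
  | pop r f, emb, _, none =>
    .pop (some r) (fun _ o => o) (.goto fun o => emb (some ⟨o, entry (f o)⟩))
  | pop _ f, emb, exit, some ⟨o, l⟩ => compile (f o) (fun l => emb (some ⟨o, l⟩)) exit l
  | loop r halts f, emb, exit, none =>
    .peek (some r) (fun _ o => o) (.branch halts (.goto fun _ => exit)
      (.pop (some r) (fun v _ => v) (.goto fun o => emb (some ⟨o, entry (f o)⟩))))
  | loop _ _ f, emb, _, some ⟨o, l⟩ => compile (f o) (fun l => emb (some ⟨o, l⟩)) (emb none) l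

/-- The stacks of the compiled machine, while its answer stack is still empty. -/
def contents (s : R → List A) : (k : Option R) → List (StackAlphabet R A k)
  | none => []
  | some r => s r

section Compile

variable [DecidableEq R]

theorem update_contents (s : R → List A) (r : R) (l : List A) :
    Function.update (contents s) (some r) l = contents (Function.update s r l) := by
  funext k
  rcases k with _ | k
  · exact Function.update_of_ne (by simp) _ _
  · by_cases h : k = r
    · subst h
      exact (Function.update_self ..).trans (Function.update_self k l s).symm
    · exact (Function.update_of_ne (by simpa using h) _ _).trans
        (Function.update_of_ne h _ _).symm

theorem step_eq {Λ : Type} {M : Λ → TM2.Stmt (StackAlphabet R A) Λ (Option A)} {l : Λ}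
    {q : TM2.Stmt (StackAlphabet R A) Λ (Option A)} {v : Option A}
    {S : (k : Option R) → List (StackAlphabet R A k)}
    {c : TM2.Cfg (StackAlphabet R A) Λ (Option A)} (h : M l = q) (hc : TM2.stepAux q v S = c) :
    flip bind (TM2.step M) (some ⟨some l, v, S⟩) = some c := by
  subst h hc
  rfl

/-- If every control point of `p` carries its compiled statement, then the machine simulates the
execution of `p` step by step. -/
theorem Exec.simulate {Λ : Type} {M : Λ → TM2.Stmt (StackAlphabet R A) Λ (Option A)}
    {p : Prog R A} {s s' : R → List A} {n : ℕ} (h : Exec p s s' n) :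
    ∀ (emb : Label p → Λ) (exit : Λ), (∀ l, M (emb l) = compile p emb exit l) →
      ∀ v, ∃ v', (flip bind (TM2.step M))^[n] (some ⟨some (emb (entry p)), v, contents s⟩) =
        some ⟨some exit, v', contents s'⟩ := by
  induction h with
  | skip s =>
    intro emb exit hM v
    exact ⟨v, step_eq (hM _) rfl⟩
  | push r a s =>
    intro emb exit hM v
    exact ⟨v, step_eq (hM _) (congrArg (TM2.Cfg.mk _ _) (update_contents s r (a :: s r)))⟩
  | @seq p q s s' s'' m n _ _ ihp ihq =>
    intro emb exit hM v
    obtain ⟨v₁, h₁⟩ := ihp (emb ∘ .inl) (emb (.inr (entry q))) (fun l => hM (.inl l)) v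
    obtain ⟨v₂, h₂⟩ := ihq (emb ∘ .inr) exit (fun l => hM (.inr l)) v₁
    refine ⟨v₂, ?_⟩
    rw [Function.iterate_add_apply]
    exact (congrArg _ h₁).trans h₂
  | @pop r f s s' n _ ih =>
    intro emb exit hM v
    obtain ⟨v₁, h₁⟩ := ih (fun l => emb (some ⟨_, l⟩)) exit (fun l => hM (some ⟨_, l⟩))
      (s r).head?
    refine ⟨v₁, ?_⟩
    rw [Function.iterate_succ_apply]
    refine (congrArg _ ?_).trans h₁
    exact step_eq (hM _) (congrArg (TM2.Cfg.mk _ _) (update_contents s r (s r).tail))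
  | @halts r halts f s hs =>
    intro emb exit hM v
    refine ⟨(s r).head?, step_eq (hM _) ?_⟩
    exact (congrArg (fun b => cond b _ _) hs)
  | @step r halts f s s' s'' m n hs _ _ ih₁ ih₂ =>
    intro emb exit hM v
    obtain ⟨v₁, h₁⟩ := ih₁ (fun l => emb (some ⟨_, l⟩)) (emb none) (fun l => hM (some ⟨_, l⟩))
      (s r).head?
    obtain ⟨v₂, h₂⟩ := ih₂ emb exit hM v₁
    refine ⟨v₂, ?_⟩
    rw [Function.iterate_add_apply, Function.iterate_succ_apply]
    refine (congrArg _ (Eq.trans (congrArg _ ?_) h₁)).trans h₂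
    refine step_eq (hM _) ((congrArg (fun b => cond b _ _) hs).trans ?_)
    exact congrArg (TM2.Cfg.mk _ _) (update_contents s r (s r).tail)

/-- The machine that runs `p` on an input written on the stack `inp`, and then answers whether
the symbol on top of the stack `res` is `yes`. All its stack alphabets are finite. -/
noncomputable def machine [Fintype R] [Fintype A] [DecidableEq A] (p : Prog R A) (inp res : R)
    (yes : A) : FinTM2 where
  K := Option R
  k₀ := some inp
  k₁ := none
  Γ := StackAlphabet R A
  Λ := Option (Label p)
  main := some (entry p)
  ΛFin := haveI := finite_label p; Fintype.ofFinite _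
  σ := Option A
  initialState := none
  Γk₀Fin := inferInstanceAs (Fintype A)
  m
    | some l => compile p some none l
    | none => .pop (some res) (fun _ o => o)
        (.push none (fun o => decide (o = some yes)) (.load (fun _ => none) .halt))

end Compile

/-- A decision problem is in `P` if it is decided by a stack program that runs in polynomial time
and leaves all stacks empty, except for one symbol that is `yes` if and only if the input is to be
accepted. -/
theorem inP_of_exec {α : Type} [DecidableEq R] [Fintype R] [Fintype A] [DecidableEq A]
    (enc : α → List A) (L : α → Prop) (p : Prog R A) (inp res : R) (yes : A)
    (time : Polynomial ℕ)
    (h : ∀ a, ∃ n b, (b = yes ↔ L a) ∧ n ≤ time.eval (enc a).length ∧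
      Exec p (Function.update (fun _ => []) inp (enc a)) (Function.update (fun _ => []) res [b]) n) :
    InP enc L := by
  classical
  refine ⟨{ tm := machine p inp res yes, inputAlphabet := Equiv.refl _,
            outputAlphabet := Equiv.refl _, time := time + 1, outputsFun := fun a => ?_ }⟩
  have hex : ∃ n, n ≤ time.eval (enc a).length ∧
      (flip bind (machine p inp res yes).step)^[n + 1] (some (initList (machine p inp res yes)
        ((enc a).map (Equiv.refl A).invFun))) =
      some (haltList (machine p inp res yes)
        ((Computability.encodeBool (decide (L a))).map (Equiv.refl Bool).invFun)) := by
    obtain ⟨n, b, hb, hn, hx⟩ := h a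
    refine ⟨n, hn, ?_⟩
    obtain ⟨v, hv⟩ := hx.simulate (M := (machine p inp res yes).m) some none (fun l => rfl) none
    rw [Function.iterate_succ_apply']
    have hinit : (initList (machine p inp res yes) ((enc a).map (Equiv.refl A).invFun)) =
        ⟨some (some (entry p)), none, contents (Function.update (fun _ => []) inp (enc a))⟩ := by
      refine congrArg (TM2.Cfg.mk _ _) (funext fun k => ?_)
      rcases k with _ | k
      · exact dif_neg (by simp [machine])
      · by_cases hk : k = inp
        · subst hk
          have : contents (Function.update (fun _ => []) k (enc a)) (some k) = enc a := by
            simp [contents]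
          exact (dif_pos rfl).trans ((List.map_id _).trans this.symm)
        · have : contents (Function.update (fun _ => []) inp (enc a)) (some k) = [] := by
            simp [contents, Function.update_of_ne hk]
          exact (dif_neg (by simpa [machine] using hk)).trans this.symm
    rw [hinit]
    refine (congrArg _ hv).trans (step_eq (q := (machine p inp res yes).m none) rfl ?_)
    refine congrArg (TM2.Cfg.mk _ _) (funext fun k => ?_)
    have hpop : contents (Function.update (fun _ => []) res [b]) (some res) = [b] := by
      simp [contents]
    rcases k with _ | k
    · refine (Function.update_self ..).trans (Eq.trans ?_ (dif_pos rfl).symm)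
      rw [hpop]
      simp only [hb, Computability.encodeBool, List.head?_cons, Option.some.injEq]
      rfl
    · refine (Function.update_of_ne (by simp) _ _).trans
        (Eq.trans ?_ (dif_neg (by simp [machine])).symm)
      rw [hpop, update_contents]
      by_cases hk : k = res
      · subst hk
        simp only [contents, Function.update_self, List.tail_cons]
        rfl
      · simp only [contents, Function.update_of_ne hk]
        rfl
  exact
    { steps := hex.choose + 1
      evals_in_steps := hex.choose_spec.2
      steps_le_m := by simpa using hex.choose_spec.1 }

end Prog

/-! ### The stacks used by the decision procedure -/

/-- The names of the stacks. The input is kept on `inp` and `inp2` (the part not yet read and,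
reversed, the part already read), the current table of values on `tab` and `tab2` in the same way;
`new` receives the next table (reversed), `acc`, `val`, `bnd` hold single values, `t1`, `t2` and
`flg` are scratch space, `res` and `bad` hold one-bit results, and `clk` counts rounds. -/
inductive Reg where
  | inp | inp2 | tab | tab2 | new | acc | val | bnd | t1 | t2 | flg | res | bad | clk
  deriving DecidableEq

instance : Fintype Reg where
  elems := {.inp, .inp2, .tab, .tab2, .new, .acc, .val, .bnd, .t1, .t2, .flg, .res, .bad, .clk}
  complete r := by cases r <;> decide

/-- The contents of all stacks. -/
@[ext] structure Store where
  inp : List Γ' := []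
  inp2 : List Γ' := []
  tab : List Γ' := []
  tab2 : List Γ' := []
  new : List Γ' := []
  acc : List Γ' := []
  val : List Γ' := []
  bnd : List Γ' := []
  t1 : List Γ' := []
  t2 : List Γ' := []
  flg : List Γ' := []
  res : List Γ' := []
  bad : List Γ' := []
  clk : List Γ' := []

namespace Store

/-- The contents of a stack. -/
def get (s : Store) : Reg → List Γ'
  | .inp => s.inp | .inp2 => s.inp2 | .tab => s.tab | .tab2 => s.tab2 | .new => s.new
  | .acc => s.acc | .val => s.val | .bnd => s.bnd | .t1 => s.t1 | .t2 => s.t2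
  | .flg => s.flg | .res => s.res | .bad => s.bad | .clk => s.clk

/-- Replace the contents of a stack. -/
def set (s : Store) (r : Reg) (l : List Γ') : Store :=
  match r with
  | .inp => { s with inp := l } | .inp2 => { s with inp2 := l } | .tab => { s with tab := l }
  | .tab2 => { s with tab2 := l } | .new => { s with new := l } | .acc => { s with acc := l }
  | .val => { s with val := l } | .bnd => { s with bnd := l } | .t1 => { s with t1 := l }
  | .t2 => { s with t2 := l } | .flg => { s with flg := l } | .res => { s with res := l }
  | .bad => { s with bad := l } | .clk => { s with clk := l }

theorem get_set (s : Store) (r : Reg) (l : List Γ') :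
    (s.set r l).get = Function.update s.get r l := by
  funext k
  cases r <;> cases k <;> rfl

theorem get_injective : Function.Injective get := fun s s' h => by
  ext1
  exacts [congrFun h .inp, congrFun h .inp2, congrFun h .tab, congrFun h .tab2, congrFun h .new,
    congrFun h .acc, congrFun h .val, congrFun h .bnd, congrFun h .t1, congrFun h .t2,
    congrFun h .flg, congrFun h .res, congrFun h .bad, congrFun h .clk]

end Store

/-- The programs of the decision procedure. -/
abbrev Code := Prog Reg Γ'

/-- The program `p` leads from the store `s` to the store `s'` in at most `t` steps. -/
def Runs (p : Code) (s s' : Store) (t : ℕ) : Prop := ∃ n ≤ t, p.Exec s.get s'.get n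

namespace Runs

variable {p q : Code} {s s' s'' : Store} {m n t t' : ℕ} {r : Reg} {halts : Option Γ' → Bool}
  {f : Option Γ' → Code}

theorem mono (h : Runs p s s' t) (ht : t ≤ t') : Runs p s s' t' :=
  let ⟨n, hn, hx⟩ := h
  ⟨n, hn.trans ht, hx⟩

theorem skip : Runs .skip s s 1 := ⟨1, le_rfl, .skip _⟩

theorem push (r : Reg) (a : Γ') (s : Store) : Runs (.push r a) s (s.set r (a :: s.get r)) 1 :=
  ⟨1, le_rfl, by rw [Store.get_set]; exact .push ..⟩

theorem seq (h₁ : Runs p s s' m) (h₂ : Runs q s' s'' n) : Runs (.seq p q) s s'' (m + n) :=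
  let ⟨i, hi, hx⟩ := h₁
  let ⟨j, hj, hy⟩ := h₂
  ⟨j + i, by omega, .seq hx hy⟩

theorem pop (h : Runs (f (s.get r).head?) (s.set r (s.get r).tail) s' n) :
    Runs (.pop r f) s s' (n + 1) := by
  obtain ⟨i, hi, hx⟩ := h
  rw [Store.get_set] at hx
  exact ⟨i + 1, by omega, .pop hx⟩

theorem loop_halt (h : halts (s.get r).head? = true) : Runs (.loop r halts f) s s 1 :=
  ⟨1, le_rfl, .halts h⟩

theorem loop_step (h : halts (s.get r).head? = false)
    (h₁ : Runs (f (s.get r).head?) (s.set r (s.get r).tail) s' m)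
    (h₂ : Runs (.loop r halts f) s' s'' n) : Runs (.loop r halts f) s s'' (n + (m + 1)) := by
  obtain ⟨i, hi, hx⟩ := h₁
  obtain ⟨j, hj, hy⟩ := h₂
  rw [Store.get_set] at hx
  exact ⟨j + (i + 1), by omega, .step h hx hy⟩

/-- A loop that processes the elements of a list one after the other. `S pre post` is the store
when the elements of `pre` have been processed and those of `post` have not. -/
theorem loop_list {α : Type} (S : List α → List α → Store) (C : ℕ) (l : List α)
    (hstep : ∀ pre a post, pre ++ a :: post = l →
      halts ((S pre (a :: post)).get r).head? = false ∧
      Runs (f ((S pre (a :: post)).get r).head?)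
        ((S pre (a :: post)).set r ((S pre (a :: post)).get r).tail) (S (pre ++ [a]) post) C)
    (hhalt : halts ((S l []).get r).head? = true) :
    Runs (.loop r halts f) (S [] l) (S l []) (l.length * (C + 1) + 1) := by
  have key : ∀ post pre, pre ++ post = l →
      Runs (.loop r halts f) (S pre post) (S l []) (post.length * (C + 1) + 1) := by
    intro post
    induction post with
    | nil =>
      intro pre h
      obtain rfl : pre = l := by simpa using h
      exact (loop_halt hhalt).mono (by simp)
    | cons a post ih =>
      intro pre h
      obtain ⟨h₁, h₂⟩ := hstep pre a post h
      refine (loop_step h₁ h₂ (ih (pre ++ [a]) (by simpa using h))).mono ?_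
      simp only [List.length_cons]
      ring_nf
      omega
  exact key l [] rfl

end Runs

/-! ### Elementary programs -/

infixr:60 " ;; " => Prog.seq

/-- Push a symbol, if there is one. -/
def pushOpt (r : Reg) : Option Γ' → Code
  | some a => .push r a
  | none => .skip

/-- Pour the stack `r` onto the stack `r'`; this reverses the order of the symbols. -/
def move (r r' : Reg) : Code := .loop r Option.isNone (pushOpt r')

/-- Empty the stack `r`. -/
def clear (r : Reg) : Code := .loop r Option.isNone fun _ => .skip

theorem runs_move {r r' : Reg} (h : r ≠ r') (s : Store) :
    Runs (move r r') s ((s.set r []).set r' ((s.get r).reverse ++ s.get r'))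
      (2 * (s.get r).length + 1) := by
  have key := Runs.loop_list (r := r) (halts := Option.isNone) (f := pushOpt r')
    (fun pre post => (s.set r post).set r' (pre.reverse ++ s.get r')) 1 (s.get r) ?_ ?_
  · have h₀ : (s.set r (s.get r)).set r' (([] : List Γ').reverse ++ s.get r') = s := by
      apply Store.get_injective
      simp [Store.get_set]
    rw [h₀] at key
    exact key.mono (by omega)
  · intro pre a post _
    have hget : ((s.set r (a :: post)).set r' (pre.reverse ++ s.get r')).get r = a :: post := by
      rw [Store.get_set, Function.update_of_ne h, Store.get_set, Function.update_self]
    simp only [hget, List.head?_cons, Option.isNone_some, true_and, pushOpt, List.tail_cons]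
    have hp := Runs.push r' a (((s.set r (a :: post)).set r' (pre.reverse ++ s.get r')).set r post)
    convert hp using 1
    apply Store.get_injective
    simp only [Store.get_set, Function.update_of_ne h.symm, Function.update_self]
    funext k
    simp only [Function.update_apply]
    split_ifs <;> simp_all
  · simp [Store.get_set, Function.update_of_ne h]

theorem runs_clear (r : Reg) (s : Store) :
    Runs (clear r) s (s.set r []) (2 * (s.get r).length + 1) := by
  have key := Runs.loop_list (r := r) (halts := Option.isNone) (f := fun _ => .skip)
    (fun _ post => s.set r post) 1 (s.get r) ?_ ?_
  · have h₀ : s.set r (s.get r) = s := by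
      apply Store.get_injective
      simp [Store.get_set]
    rw [h₀] at key
    exact key.mono (by omega)
  · intro pre a post _
    simp only [Store.get_set, Function.update_self, List.head?_cons, Option.isNone_some, true_and,
      List.tail_cons]
    have hp : Runs .skip (s.set r post) (s.set r post) 1 := Runs.skip
    convert hp using 1
    apply Store.get_injective
    simp only [Store.get_set, Function.update_idem]
  · simp [Store.get_set]

/-! ### Arithmetic on binary numerals -/

/-- The number with the given binary digits, least significant digit first. Leading zeros
are allowed. -/
def num : List Bool → ℕ
  | [] => 0
  | b :: l => b.toNat + 2 * num l

theorem num_encodeNat (c : ℕ) : num (encodeNat c) = c := by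
  have hpos : ∀ p : PosNum, num (Computability.encodePosNum p) = (p : ℕ) := by
    intro p
    induction p with
    | one => rfl
    | bit1 p ih => simp [Computability.encodePosNum, num, ih]; omega
    | bit0 p ih => simp [Computability.encodePosNum, num, ih]; omega
  have hnum : ∀ a : Num, num (Computability.encodeNum a) = (a : ℕ) := by
    rintro (_ | p)
    · rfl
    · exact hpos p
  simp [encodeNat, hnum]

theorem encodeNat_eq_nil_iff (c : ℕ) : encodeNat c = [] ↔ c = 0 := by
  constructor
  · intro h
    rw [← num_encodeNat c, h]
    rfl
  · rintro rfl
    rfl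

/-- Increment. -/
def inc : List Bool → List Bool
  | [] => [true]
  | false :: l => true :: l
  | true :: l => false :: inc l

theorem num_inc (l : List Bool) : num (inc l) = num l + 1 := by
  induction l with
  | nil => rfl
  | cons b l ih => cases b <;> simp [inc, num, ih]; omega; omega

theorem length_inc_le (l : List Bool) : (inc l).length ≤ l.length + 1 := by
  induction l with
  | nil => simp [inc]
  | cons b l ih => cases b <;> simp [inc]; omega

/-- Truncated decrement; the result of decrementing zero is the empty numeral. -/
def dec : List Bool → List Bool
  | [] => []
  | true :: l => false :: l
  | false :: l => if num l = 0 then [] else true :: dec l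

theorem num_dec (l : List Bool) : num (dec l) = num l - 1 := by
  induction l with
  | nil => rfl
  | cons b l ih =>
    cases b
    · by_cases h : num l = 0 <;> simp [dec, num, h, ih]
      omega
    · simp [dec, num]

theorem length_dec_le (l : List Bool) : (dec l).length ≤ l.length := by
  induction l with
  | nil => rfl
  | cons b l ih =>
    cases b
    · by_cases h : num l = 0 <;> simp [dec, h, ih]
    · simp [dec]

/-- Comparison of two numerals that have been read up to some digit: `b` tells the result for
the digits already read, and a more significant digit in which the numerals differ overrules it. -/
def leFrom : Bool → List Bool → List Bool → Bool
  | b, [], [] => b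
  | b, [], y :: q => leFrom (b || y) [] q
  | b, x :: p, [] => leFrom (b && !x) p []
  | b, x :: p, y :: q => leFrom (if x = y then b else y) p q

theorem leFrom_iff (b : Bool) (p q : List Bool) :
    leFrom b p q = true ↔ num p < num q ∨ num p = num q ∧ b = true := by
  induction p generalizing b q with
  | nil =>
    induction q generalizing b with
    | nil => simp [leFrom]
    | cons y q ih =>
      rw [leFrom, ih]
      cases y <;> cases b <;> simp [num] <;> omega
  | cons x p ih =>
    cases q with
    | nil =>
      rw [leFrom, ih]
      cases x <;> cases b <;> simp [num]
    | cons y q =>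
      rw [leFrom, ih]
      cases x <;> cases y <;> cases b <;> simp [num] <;> omega

/-! ### Values: binary numerals and infinity -/

/-- A value is a binary numeral, or infinity (`none`). -/
abbrev Value := Option (List Bool)

namespace Value

/-- The extended natural number denoted by a value. -/
def toENat : Value → ℕ∞
  | none => ⊤
  | some l => num l

/-- The string that represents a value. -/
def encode : Value → List Γ'
  | none => [Γ'.blank]
  | some l => l.map Γ'.bit

/-- Truncated decrement. -/
def pred (v : Value) : Value := v.map dec

/-- The maximum of two values if `mx` is true, and otherwise their minimum. -/
def select (mx : Bool) : Value → Value → Value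
  | none, q => if mx then none else q
  | some p, none => if mx then none else some p
  | some p, some q => if leFrom true p q = mx then some q else some p

theorem lt_toENat_pred (v : Value) (i : ℕ) :
    (i : ℕ∞) < toENat v.pred ↔ ((i + 1 : ℕ) : ℕ∞) < toENat v := by
  rcases v with _ | l
  · simp only [pred, Option.map_none, toENat]
    exact iff_of_true (WithTop.coe_lt_top _) (WithTop.coe_lt_top _)
  · simp only [pred, Option.map_some, toENat, num_dec, Nat.cast_lt]
    omega

theorem toENat_select_true (p q : Value) :
    (select true p q).toENat = max p.toENat q.toENat := by
  rcases p with _ | p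
  · simp [select, toENat]
  rcases q with _ | q
  · simp [select, toENat]
  by_cases h : leFrom true p q = true
  · have := (leFrom_iff ..).1 h
    simp only [select, h, if_true, toENat]
    rw [max_eq_right (by exact_mod_cast (by omega))]
  · have := mt (leFrom_iff ..).2 h
    simp only [select, h, Bool.false_eq_true, if_false, toENat]
    rw [max_eq_left (by exact_mod_cast (by simp at this; omega))]

theorem toENat_select_false (p q : Value) :
    (select false p q).toENat = min p.toENat q.toENat := by
  rcases p with _ | p
  · simp [select, toENat]
  rcases q with _ | q
  · simp [select, toENat]
  by_cases h : leFrom true p q = true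
  · have := (leFrom_iff ..).1 h
    simp only [select, h, toENat, Bool.true_eq_false, if_false]
    rw [min_eq_left (by exact_mod_cast (by omega))]
  · have := mt (leFrom_iff ..).2 h
    simp only [select, Bool.not_eq_true] at h ⊢
    simp only [h, if_true, toENat]
    rw [min_eq_right (by exact_mod_cast (by simp at this; omega))]

theorem length_encode_pred_le (v : Value) : (encode v.pred).length ≤ v.encode.length := by
  rcases v with _ | l
  · rfl
  · simpa [pred, encode] using length_dec_le l

theorem length_encode_select_le {mx : Bool} {p q : Value} {W : ℕ} (hp : p.encode.length ≤ W)
    (hq : q.encode.length ≤ W) : (select mx p q).encode.length ≤ W := by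
  rcases p with _ | p <;> rcases q with _ | q <;> simp only [select] <;> split_ifs <;> assumption

end Value

namespace Runs

variable {p q : Code} {s s' s'' : Store} {m n t t' : ℕ} {r : Reg} {halts : Option Γ' → Bool}
  {f : Option Γ' → Code}

theorem seq_loop_halt (h : halts (s.get r).head? = true) (h' : Runs q s s' n) :
    Runs (.loop r halts f ;; q) s s' (n + 1) :=
  ((loop_halt h).seq h').mono (by omega)

theorem seq_loop_step (h : halts (s.get r).head? = false)
    (h₁ : Runs (f (s.get r).head?) (s.set r (s.get r).tail) s' m)
    (h₂ : Runs (.loop r halts f ;; q) s' s'' n) :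
    Runs (.loop r halts f ;; q) s s'' (n + (m + 1)) := by
  obtain ⟨i, hi, hx⟩ := h₁
  obtain ⟨j, hj, hy⟩ := h₂
  rw [Store.get_set] at hx
  cases hy with
  | seq hl hq => exact ⟨_, by omega, .seq (.step h hx hl) hq⟩

theorem congr (h : Runs p s s' t) (hs : s' = s'') (ht : t ≤ t') : Runs p s s'' t' :=
  hs ▸ h.mono ht

end Runs

/-! ### Programs for arithmetic on values -/

/-- The exit condition "the top symbol is not `a`". -/
def isNot (a : Γ') (o : Option Γ') : Bool := decide (o ≠ some a)

/-- Replace the value on `val` by its predecessor. -/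
def predCode : Code :=
  .loop .val (isNot (.bit false)) (fun _ => .push .t1 (.bit true)) ;;
  .pop .val fun o => match o with
    | some (.bit _) => .push .t1 (.bit false) ;; move .t1 .val
    | some a => .push .val a
    | none => clear .t1

theorem runs_predCode (s : Store) (v : Value) :
    Runs predCode { s with val := v.encode, t1 := [] } { s with val := v.pred.encode, t1 := [] }
      (4 * v.encode.length + 8) := by
  rcases v with _ | l
  · refine (Runs.seq_loop_halt rfl (Runs.pop (Runs.push _ _ _))).mono (by simp)
  have key : ∀ (l : List Bool) (k : ℕ),
      Runs predCode { s with val := l.map .bit, t1 := List.replicate k (.bit true) }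
        { s with
          val := if num l = 0 then [] else List.replicate k (.bit true) ++ (dec l).map .bit
          t1 := [] } (4 * l.length + 2 * k + 8) := by
    intro l
    induction l with
    | nil =>
      intro k
      refine (Runs.seq_loop_halt rfl (Runs.pop (runs_clear _ _))).mono ?_
      simp [Store.get, Store.set]
    | cons b l ih =>
      intro k
      cases b
      · have := ih (k + 1)
        have hd : (if num (false :: l) = 0 then [] else
            List.replicate k (Γ'.bit true) ++ (dec (false :: l)).map .bit) =
            (if num l = 0 then [] else
              List.replicate (k + 1) (Γ'.bit true) ++ (dec l).map .bit) := by
          by_cases h : num l = 0 <;>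
            simp [num, dec, h, List.replicate_succ', -List.replicate_append_replicate]
        rw [hd]
        refine (Runs.seq_loop_step rfl (Runs.push _ _ _) this).mono ?_
        simp only [List.length_cons]
        omega
      · have hn : num (true :: l) ≠ 0 := by simp [num]
        rw [if_neg hn]
        have hm := runs_move (r := .t1) (r' := .val) (by decide)
          { s with val := l.map .bit, t1 := .bit false :: List.replicate k (.bit true) }
        refine (Runs.seq_loop_halt rfl (Runs.pop ((Runs.push _ _ _).seq hm))).congr ?_ ?_
        · simp [Store.set, Store.get, dec]
        · simp [Store.get]
          omega
  refine (key l 0).congr ?_ ?_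
  · by_cases h : num l = 0
    · have : dec l = [] := by
        cases l with
        | nil => rfl
        | cons b l => cases b <;> simp_all [num, dec]
      simp [Value.pred, Value.encode, h, this]
    · simp [Value.pred, Value.encode, h]
  · simp [Value.encode]

/-- Increment the numeral on `bnd`. -/
def incCode : Code :=
  .loop .bnd (isNot (.bit true)) (fun _ => .push .t1 (.bit false)) ;;
  .pop .bnd fun _ => .push .t1 (.bit true) ;; move .t1 .bnd

theorem runs_incCode (s : Store) (l : List Bool) :
    Runs incCode { s with bnd := l.map .bit, t1 := [] } { s with bnd := (inc l).map .bit, t1 := [] }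
      (4 * l.length + 8) := by
  have key : ∀ (l : List Bool) (k : ℕ),
      Runs incCode { s with bnd := l.map .bit, t1 := List.replicate k (.bit false) }
        { s with bnd := List.replicate k (.bit false) ++ (inc l).map .bit, t1 := [] }
        (4 * l.length + 2 * k + 8) := by
    intro l
    induction l with
    | nil =>
      intro k
      have hm := runs_move (r := .t1) (r' := .bnd) (by decide)
        { s with bnd := [], t1 := .bit true :: List.replicate k (.bit false) }
      refine (Runs.seq_loop_halt rfl (Runs.pop ((Runs.push _ _ _).seq hm))).congr ?_ ?_
      · simp [Store.set, Store.get, inc]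
      · simp [Store.get]
        omega
    | cons b l ih =>
      intro k
      cases b
      · have hm := runs_move (r := .t1) (r' := .bnd) (by decide)
          { s with bnd := l.map .bit, t1 := .bit true :: List.replicate k (.bit false) }
        refine (Runs.seq_loop_halt rfl (Runs.pop ((Runs.push _ _ _).seq hm))).congr ?_ ?_
        · simp [Store.set, Store.get, inc]
        · simp [Store.get]
          omega
      · refine (Runs.seq_loop_step rfl (Runs.push _ _ _) (ih (k + 1))).congr ?_ ?_
        · simp [inc, List.replicate_succ', -List.replicate_append_replicate]
        · simp only [List.length_cons]
          omega
  exact key l 0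

/-- Does the symbol represent the digit one? -/
def isOne (o : Option Γ') : Bool := decide (o = some (.bit true))

/-- Update the result of a digitwise comparison on `flg` by two further digits. -/
def compareDigits (x y : Bool) : Code :=
  if x = y then .skip else .pop .flg fun _ => .push .flg (.bit y)

theorem runs_compareDigits (x y b : Bool) (s : Store) :
    Runs (compareDigits x y) { s with flg := [.bit b] }
      { s with flg := [.bit (if x = y then b else y)] } 2 := by
  unfold compareDigits
  split_ifs
  · exact Runs.skip.mono (by omega)
  · exact Runs.pop (Runs.push _ _ _)

/-- Compare the numerals on `val` and `bnd`, which are moved to `t1` and `t2`. -/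
def compareCode : Code :=
  .loop .val Option.isNone (fun o => pushOpt .t1 o ;;
    .pop .bnd fun o' => pushOpt .t2 o' ;; compareDigits (isOne o) (isOne o')) ;;
  .loop .bnd Option.isNone (fun o' => pushOpt .t2 o' ;; compareDigits false (isOne o'))

theorem runs_compareCode (s : Store) (b : Bool) (p q : List Bool) (x y : List Γ') :
    Runs compareCode
      { s with val := p.map .bit, bnd := q.map .bit, t1 := x, t2 := y, flg := [.bit b] }
      { s with
        val := [], bnd := [], t1 := (p.map .bit).reverse ++ x, t2 := (q.map .bit).reverse ++ y
        flg := [.bit (leFrom b p q)] } (6 * p.length + 4 * q.length + 2) := by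
  induction p generalizing b q x y with
  | nil =>
    refine Runs.mono (Runs.seq_loop_halt (n := 4 * q.length + 1) rfl ?_) (by simp)
    induction q generalizing b y with
    | nil => exact Runs.congr (Runs.loop_halt rfl) (by simp [leFrom]) (by simp)
    | cons d q ih =>
      have hc := runs_compareDigits false (isOne (some (.bit d))) b
        { s with val := [], bnd := q.map .bit, t1 := x, t2 := .bit d :: y }
      refine (Runs.loop_step rfl ((Runs.push _ _ _).seq hc) (ih _ _)).congr ?_ ?_
      · cases d <;> simp [leFrom, isOne]
      · simp only [List.length_cons]
        omega
  | cons c p ih =>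
    have hone : ∀ d, isOne (some (.bit d)) = d := by intro d; cases d <;> rfl
    cases q with
    | nil =>
      have hc := runs_compareDigits (isOne (some (.bit c))) false b
        { s with val := p.map .bit, bnd := [], t1 := .bit c :: x, t2 := y }
      refine (Runs.seq_loop_step rfl ((Runs.push _ _ _).seq (Runs.pop (Runs.skip.seq hc)))
        (ih _ [] _ _)).congr ?_ ?_
      · cases c <;> simp [leFrom, isOne]
      · simp only [List.length_cons]
        omega
    | cons d q =>
      have hc := runs_compareDigits (isOne (some (.bit c))) (isOne (some (.bit d))) b
        { s with val := p.map .bit, bnd := q.map .bit, t1 := .bit c :: x, t2 := .bit d :: y }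
      refine (Runs.seq_loop_step rfl ((Runs.push _ _ _).seq (Runs.pop ((Runs.push _ _ _).seq hc)))
        (ih _ q _ _)).congr ?_ ?_
      · simp [leFrom, hone]
      · simp only [List.length_cons]
        omega

/-- Compare the finite values on `val` and `bnd`, and leave the larger one (if `mx` is true) or the
smaller one on `val`. -/
def selectFinite (mx : Bool) : Code :=
  .push .flg (.bit true) ;; compareCode ;;
  .pop .flg fun o =>
    if o = some (.bit mx) then clear .t1 ;; move .t2 .val else clear .t2 ;; move .t1 .val

/-- Replace the values on `val` and `bnd` by their maximum (if `mx` is true) or minimum, left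
on `val`. -/
def selectCode (mx : Bool) : Code :=
  .pop .val fun o => match o with
    | some .blank =>
      if mx then clear .bnd ;; .push .val .blank else move .bnd .t1 ;; move .t1 .val
    | o => pushOpt .val o ;; .pop .bnd fun o' => match o' with
      | some .blank => if mx then clear .val ;; .push .val .blank else .skip
      | o' => pushOpt .bnd o' ;; selectFinite mx

theorem runs_selectFinite (s : Store) (mx : Bool) (p q : List Bool) :
    Runs (selectFinite mx)
      { s with val := p.map .bit, bnd := q.map .bit, t1 := [], t2 := [], flg := [] }
      { s with
        val := (Value.select mx (some p) (some q)).encode, bnd := [], t1 := [], t2 := [], flg := [] }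
      (8 * p.length + 8 * q.length + 8) := by
  have hc := runs_compareCode s true p q [] []
  have hend : Runs (if some (Γ'.bit (leFrom true p q)) = some (.bit mx)
        then clear .t1 ;; move .t2 .val else clear .t2 ;; move .t1 .val)
      { s with
        val := [], bnd := [], t1 := (p.map .bit).reverse ++ [], t2 := (q.map .bit).reverse ++ []
        flg := [] }
      { s with
        val := (Value.select mx (some p) (some q)).encode, bnd := [], t1 := [], t2 := [], flg := [] }
      (2 * p.length + 2 * q.length + 2) := by
    by_cases h : leFrom true p q = mx
    · rw [if_pos (by rw [h])]
      refine ((runs_clear .t1 _).seq (runs_move (r := .t2) (r' := .val) (by decide) _)).congr ?_ ?_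
      · simp [Store.set, Store.get, Value.select, h, Value.encode]
      · simp [Store.set, Store.get]
        omega
    · rw [if_neg (by simpa using h)]
      refine ((runs_clear .t2 _).seq (runs_move (r := .t1) (r' := .val) (by decide) _)).congr ?_ ?_
      · simp [Store.set, Store.get, Value.select, h, Value.encode]
      · simp [Store.set, Store.get]
        omega
  exact ((Runs.push _ _ _).seq (hc.seq (Runs.pop hend))).mono (by omega)

theorem runs_selectCode (s : Store) (mx : Bool) (p q : Value) :
    Runs (selectCode mx)
      { s with val := p.encode, bnd := q.encode, t1 := [], t2 := [], flg := [] }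
      { s with val := (Value.select mx p q).encode, bnd := [], t1 := [], t2 := [], flg := [] }
      (8 * p.encode.length + 8 * q.encode.length + 12) := by
  rcases p with _ | p
  · cases mx
    · refine (Runs.pop ((runs_move (r := .bnd) (r' := .t1) (by decide) _).seq
        (runs_move (r := .t1) (r' := .val) (by decide) _))).congr ?_ ?_
      · simp [Store.set, Store.get, Value.select, Value.encode]
      · simp [Store.set, Store.get]
        omega
    · refine (Runs.pop ((runs_clear .bnd _).seq (Runs.push _ _ _))).congr ?_ ?_
      · simp [Store.set, Store.get, Value.select, Value.encode]
      · simp [Store.set, Store.get]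
        omega
  rcases q with _ | q
  · have hb : Runs (if mx then clear .val ;; .push .val .blank else .skip)
        { s with val := p.map .bit, bnd := [], t1 := [], t2 := [], flg := [] }
        { s with
          val := (Value.select mx (some p) none).encode, bnd := [], t1 := [], t2 := [], flg := [] }
        (2 * p.length + 2) := by
      cases mx
      · exact Runs.skip.congr (by simp [Value.select, Value.encode]) (by omega)
      · exact ((runs_clear .val _).seq (Runs.push _ _ _)).congr
          (by simp [Store.set, Store.get, Value.select, Value.encode]) (by simp [Store.get])
    rcases p with _ | ⟨c, p⟩
    · exact (Runs.pop (Runs.skip.seq (Runs.pop hb))).mono (by simp [Value.encode])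
    · refine (Runs.pop ((Runs.push _ _ _).seq (Runs.pop hb))).mono ?_
      simp [Value.encode]
      omega
  have hf := runs_selectFinite s mx p q
  rcases p with _ | ⟨c, p⟩ <;> rcases q with _ | ⟨d, q⟩
  · exact (Runs.pop (Runs.skip.seq (Runs.pop (Runs.skip.seq hf)))).mono (by simp [Value.encode])
  · refine (Runs.pop (Runs.skip.seq (Runs.pop ((Runs.push _ _ _).seq hf)))).mono ?_
    simp [Value.encode]
    omega
  · refine (Runs.pop ((Runs.push _ _ _).seq (Runs.pop (Runs.skip.seq hf)))).mono ?_
    simp [Value.encode]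
    omega
  · refine (Runs.pop ((Runs.push _ _ _).seq (Runs.pop ((Runs.push _ _ _).seq hf)))).mono ?_
    simp [Value.encode]
    omega

/-! ### One round of value iteration -/

/-- A flag on a stack. -/
def flag (b : Bool) : List Γ' := if b then [Γ'.blank] else []

/-- The value `0` or infinity. -/
def Value.start (zero : Bool) : Value := if zero then some [] else none

/-- Is the symbol a digit one or the sign for infinity? -/
def isPositive (o : Option Γ') : Bool := decide (o = some (.bit true) ∨ o = some .blank)

/-- Is the value different from zero? -/
def Value.positive (v : Value) : Bool := v.encode.any fun a => isPositive (some a)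

theorem Value.positive_iff (v : Value) : v.positive = true ↔ 0 < v.toENat := by
  rcases v with _ | l
  · simp [positive, encode, isPositive, toENat]
  · simp only [positive, encode, toENat, Nat.cast_pos]
    induction l with
    | nil => simp [num]
    | cons b l ih => cases b <;> simp_all [isPositive, num]

namespace Constraint

/-- The bound that a constraint imposes on the value of the source of an edge. The edges of
players who want a maximum (`mx`) are decreasing, so that they are available below their bound; the
edges of the other player are increasing, so that they are available from their bound on. -/
def bound : Bool → Constraint → Value
  | true, .le c => some (inc (encodeNat c))
  | true, .ge _ => none
  | false, .le c => some (encodeNat c)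
  | false, .ge c => some (encodeNat c)

/-- Does the constraint describe an edge that is not decreasing (if `mx` is true), respectively
not increasing? -/
def isBad : Bool → Constraint → Bool
  | true, .le _ => false
  | true, .ge c => decide (c ≠ 0)
  | false, .le _ => true
  | false, .ge _ => false

end Constraint

/-- The contribution of an edge to the value of its source: `w` is the decremented value of the
target of the edge, and `a` the value computed from the other edges. -/
def accumulate (mx : Bool) (w : Value) (a : Value) : Option Constraint → Value
  | none => a
  | some c => Value.select mx (Value.select (!mx) w (c.bound mx)) a

/-- The contribution of an edge to the test whether the edges are of the right kind. -/
def badEntry (mx : Bool) : Option Constraint → Bool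
  | none => false
  | some c => c.isBad mx

/-- Read the next value of the table, and put its predecessor on `val`. -/
def readValue : Code :=
  .loop .tab (fun o => decide (o = some .comma)) (fun o => pushOpt .tab2 o ;; pushOpt .t1 o) ;;
  .pop .tab (fun o => pushOpt .tab2 o) ;; move .t1 .val ;; predCode

theorem Value.ne_comma_of_mem_encode {v : Value} {a : Γ'} (h : a ∈ v.encode) : a ≠ .comma := by
  rintro rfl
  rcases v with _ | l <;> simp [Value.encode] at h

theorem runs_readValue (s : Store) (v : Value) (t : List Γ') :
    Runs readValue { s with tab := v.encode ++ .comma :: t, t1 := [], val := [] }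
      { s with
        tab := t, tab2 := .comma :: (v.encode.reverse ++ s.tab2), t1 := [], val := v.pred.encode }
      (9 * v.encode.length + 20) := by
  have h₁ := Runs.loop_list (r := .tab) (halts := fun o => decide (o = some .comma))
    (f := fun o => pushOpt .tab2 o ;; pushOpt .t1 o)
    (fun pre post => { s with
      tab := post ++ .comma :: t, tab2 := pre.reverse ++ s.tab2, t1 := pre.reverse, val := [] })
    2 v.encode ?_ rfl
  · have h₂ : Runs (.pop .tab (fun o => pushOpt .tab2 o))
        { s with
          tab := .comma :: t, tab2 := v.encode.reverse ++ s.tab2, t1 := v.encode.reverse, val := [] }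
        { s with
          tab := t, tab2 := .comma :: (v.encode.reverse ++ s.tab2), t1 := v.encode.reverse
          val := [] } 2 := Runs.pop (Runs.push _ _ _)
    have h₃ : Runs (move .t1 .val)
        { s with
          tab := t, tab2 := .comma :: (v.encode.reverse ++ s.tab2), t1 := v.encode.reverse
          val := [] }
        { s with
          tab := t, tab2 := .comma :: (v.encode.reverse ++ s.tab2), t1 := [], val := v.encode }
        (2 * v.encode.length + 1) :=
      (runs_move (by decide) _).congr (by simp [Store.set, Store.get]) (by simp [Store.get])
    have h₄ := runs_predCode
      { s with tab := t, tab2 := .comma :: (v.encode.reverse ++ s.tab2) } v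
    exact (h₁.seq (h₂.seq (h₃.seq h₄))).mono (by omega)
  · intro pre a post h
    refine ⟨?_, ?_⟩
    · have : a ≠ .comma := Value.ne_comma_of_mem_encode (v := v) (by rw [← h]; simp)
      simpa [Store.get] using this
    · exact Runs.congr ((Runs.push _ _ _).seq (Runs.push _ _ _))
        (by simp [Store.get, Store.set]) le_rfl

/-- Record that some edge is not of the right kind. -/
def setBad : Code := .pop .bad fun _ => .push .bad .blank

theorem runs_setBad (s : Store) (b : Bool) :
    Runs setBad { s with bad := flag b } { s with bad := flag true } 2 := by
  cases b <;> exact Runs.pop (Runs.push _ _ _)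

/-- Turn the constant of a constraint, on `bnd`, into its bound; `ge` tells the kind of the
constraint. -/
def boundCode : (mx ge : Bool) → Code
  | true, false => incCode
  | true, true => .pop .bnd (fun o => match o with
      | none => .skip
      | some _ => setBad) ;; clear .bnd ;; .push .bnd .blank
  | false, false => setBad
  | false, true => .skip

/-- The kind of a constraint. -/
def Constraint.isGe : Constraint → Bool
  | .le _ => false
  | .ge _ => true

/-- The constant of a constraint. -/
def Constraint.const : Constraint → ℕ
  | .le c => c
  | .ge c => c

theorem runs_boundCode (s : Store) (mx b : Bool) (c : Constraint) :
    Runs (boundCode mx c.isGe)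
      { s with bnd := (encodeNat c.const).map .bit, t1 := [], bad := flag b }
      { s with bnd := (c.bound mx).encode, t1 := [], bad := flag (b || c.isBad mx) }
      (4 * (encodeNat c.const).length + 8) := by
  rcases c with c | c <;> cases mx
  · exact (runs_setBad { s with bnd := (encodeNat c).map .bit, t1 := [] } b).congr
      (by simp [Constraint.isBad, Constraint.bound, Value.encode]) (by omega)
  · exact (runs_incCode { s with bad := flag b } (encodeNat c)).congr
      (by simp [Constraint.isBad, Constraint.bound, Value.encode]) le_rfl
  · exact Runs.skip.congr (by simp [Constraint.isBad, Constraint.bound, Constraint.const,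
      Value.encode]) (by omega)
  · have hnil := encodeNat_eq_nil_iff c
    rcases h : encodeNat c with _ | ⟨d, l⟩
    · have hc : c = 0 := hnil.1 h
      refine Runs.congr (Runs.seq (m := 2) (n := 2)
        (s' := { s with bnd := [], t1 := [], bad := flag b }) ?_
        ((runs_clear .bnd _).seq (Runs.push _ _ _))) ?_ (by omega)
      · simp only [Constraint.const, h]
        exact Runs.pop Runs.skip
      · simp [Store.set, Store.get, Constraint.isBad, Constraint.bound, Value.encode, hc]
    · have hc : c ≠ 0 := fun h0 => by simp [hnil.2 h0] at h
      refine Runs.congr (Runs.seq (m := 3)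
        (s' := { s with bnd := l.map .bit, t1 := [], bad := flag true }) ?_
        ((runs_clear .bnd _).seq (Runs.push _ _ _))) ?_ ?_
      · simp only [Constraint.const, h]
        exact Runs.pop (runs_setBad { s with bnd := l.map .bit, t1 := [] } b)
      · simp [Store.set, Store.get, Constraint.isBad, Constraint.bound, Value.encode, hc]
      · simp [Store.get, Constraint.const, h]
        omega

/-- The exit condition "the top symbol is not a digit". -/
def isNotBit : Option Γ' → Bool
  | some (.bit _) => false
  | _ => true

/-- Read an entry of the edge table and update the value on `acc`; the decremented value of the
target of the edge is on `val`. -/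
def readEntry (mx : Bool) : Code :=
  .pop .inp fun o => match o with
    | some (.bit ge) =>
      .push .inp2 (.bit ge) ;;
      .loop .inp isNotBit (fun o => pushOpt .inp2 o ;; pushOpt .t1 o) ;;
      move .t1 .bnd ;; boundCode mx ge ;; selectCode (!mx) ;;
      move .acc .t1 ;; move .t1 .bnd ;; selectCode mx ;; move .val .t1 ;; move .t1 .acc
    | o => pushOpt .inp o ;; clear .val

theorem Constraint.length_bound_le (mx : Bool) (c : Constraint) :
    (c.bound mx).encode.length ≤ (encodeNat c.const).length + 1 := by
  rcases c with c | c <;> cases mx <;> simp [bound, Value.encode, const, length_inc_le]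

theorem encodeEntry_some (c : Constraint) :
    Instance.encodeEntry (some c) = .bit c.isGe :: (encodeNat c.const).map .bit := by
  cases c <;> rfl

theorem runs_readEntry (s : Store) (mx b : Bool) (e : Option Constraint) (w a : Value) (x : Γ')
    (rest : List Γ') (hx : x = .comma ∨ x = .ket) {W : ℕ}
    (he : (Instance.encodeEntry e).length ≤ W)
    (hw : w.encode.length ≤ W) (ha : a.encode.length ≤ W) :
    Runs (readEntry mx)
      { s with
        inp := Instance.encodeEntry e ++ x :: rest, val := w.encode, acc := a.encode, bnd := []
        t1 := [], t2 := [], flg := [], bad := flag b }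
      { s with
        inp := x :: rest, inp2 := (Instance.encodeEntry e).reverse ++ s.inp2, val := []
        acc := (accumulate mx w a e).encode, bnd := [], t1 := [], t2 := [], flg := []
        bad := flag (b || badEntry mx e) } (60 * W + 60) := by
  rcases e with _ | c
  · have hb : Runs (pushOpt .inp (some x) ;; clear .val)
        { s with
          inp := rest, val := w.encode, acc := a.encode, bnd := [], t1 := [], t2 := [], flg := []
          bad := flag b }
        { s with
          inp := x :: rest, val := [], acc := a.encode, bnd := [], t1 := [], t2 := [], flg := []
          bad := flag b } (1 + (2 * w.encode.length + 1)) :=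
      (Runs.push .inp x _).seq (runs_clear .val _)
    rcases hx with rfl | rfl <;>
      exact (Runs.pop hb).congr (by simp [Instance.encodeEntry, accumulate, badEntry]) (by omega)
  · have hlen : (Instance.encodeEntry (some c)).length = (encodeNat c.const).length + 1 := by
      simp [encodeEntry_some]
    have hbl := c.length_bound_le mx
    set u := Value.select (!mx) w (c.bound mx) with hu
    have hul : u.encode.length ≤ W := Value.length_encode_select_le hw (by omega)
    have hvl : (Value.select mx u a).encode.length ≤ W := Value.length_encode_select_le hul ha
    set d := (encodeNat c.const).map Γ'.bit with hd
    have hdl : d.length = (encodeNat c.const).length := by simp [hd]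
    have h₁ := Runs.loop_list (r := .inp) (halts := isNotBit)
      (f := fun o => pushOpt .inp2 o ;; pushOpt .t1 o)
      (fun pre post => { s with
        inp := post ++ x :: rest, inp2 := pre.reverse ++ .bit c.isGe :: s.inp2, t1 := pre.reverse
        val := w.encode, acc := a.encode, bnd := [], t2 := [], flg := [], bad := flag b })
      2 d ?_ ?_
    · set s₁ : Store := { s with
        inp := x :: rest, inp2 := d.reverse ++ .bit c.isGe :: s.inp2, t2 := [], flg := [] } with hs₁
      have h₂ : Runs (move .t1 .bnd)
          { s₁ with
            t1 := d.reverse, val := w.encode, acc := a.encode, bnd := [], bad := flag b }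
          { s₁ with t1 := [], val := w.encode, acc := a.encode, bnd := d, bad := flag b }
          (2 * d.length + 1) :=
        (runs_move (by decide) _).congr (by simp [Store.set, Store.get]) (by simp [Store.get])
      have h₃ := runs_boundCode { s₁ with val := w.encode, acc := a.encode } mx b c
      have h₄ := runs_selectCode
        { s₁ with acc := a.encode, bad := flag (b || c.isBad mx) } (!mx) w (c.bound mx)
      have h₅ : Runs (move .acc .t1)
          { s₁ with
            t1 := [], val := u.encode, acc := a.encode, bnd := [], bad := flag (b || c.isBad mx) }
          { s₁ with
            t1 := a.encode.reverse, val := u.encode, acc := [], bnd := []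
            bad := flag (b || c.isBad mx) }
          (2 * a.encode.length + 1) :=
        (runs_move (by decide) _).congr (by simp [Store.set, Store.get]) (by simp [Store.get])
      have h₆ : Runs (move .t1 .bnd)
          { s₁ with
            t1 := a.encode.reverse, val := u.encode, acc := [], bnd := []
            bad := flag (b || c.isBad mx) }
          { s₁ with
            t1 := [], val := u.encode, acc := [], bnd := a.encode
            bad := flag (b || c.isBad mx) }
          (2 * a.encode.length + 1) :=
        (runs_move (by decide) _).congr (by simp [Store.set, Store.get]) (by simp [Store.get])
      have h₇ := runs_selectCode
        { s₁ with acc := [], bad := flag (b || c.isBad mx) } mx u a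
      have h₈ : Runs (move .val .t1)
          { s₁ with
            t1 := [], val := (Value.select mx u a).encode, acc := [], bnd := []
            bad := flag (b || c.isBad mx) }
          { s₁ with
            t1 := (Value.select mx u a).encode.reverse, val := [], acc := [], bnd := []
            bad := flag (b || c.isBad mx) }
          (2 * (Value.select mx u a).encode.length + 1) :=
        (runs_move (by decide) _).congr (by simp [Store.set, Store.get]) (by simp [Store.get])
      have h₉ : Runs (move .t1 .acc)
          { s₁ with
            t1 := (Value.select mx u a).encode.reverse, val := [], acc := [], bnd := []
            bad := flag (b || c.isBad mx) }
          { s₁ with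
            t1 := [], val := [], acc := (Value.select mx u a).encode, bnd := []
            bad := flag (b || c.isBad mx) }
          (2 * (Value.select mx u a).encode.length + 1) :=
        (runs_move (by decide) _).congr (by simp [Store.set, Store.get]) (by simp [Store.get])
      rw [encodeEntry_some]
      refine Runs.congr (Runs.pop ((Runs.push _ _ _).seq (h₁.seq (h₂.seq (h₃.seq (h₄.seq (h₅.seq
        (h₆.seq (h₇.seq (h₈.seq h₉)))))))))) ?_ ?_
      · simp [hs₁, hd, accumulate, badEntry, hu]
      · omega
    · intro pre y post h
      have hy : y ∈ d := by rw [← h]; simp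
      obtain ⟨y, -, rfl⟩ := List.mem_map.1 hy
      exact ⟨rfl, Runs.congr ((Runs.push _ _ _).seq (Runs.push _ _ _))
        (by simp [Store.get, Store.set]) le_rfl⟩
    · rcases hx with rfl | rfl <;> rfl

/-- The part of a row of the edge table that describes the edges to the vertices in `l`. -/
def rowText {α : Type} (e : α → Option Constraint) (l : List α) : List Γ' :=
  l.flatMap fun w => Γ'.comma :: Instance.encodeEntry (e w)

/-- The representation of the values of the vertices in `l`. -/
def tableText {α : Type} (T : α → Value) (l : List α) : List Γ' :=
  l.flatMap fun w => (T w).encode ++ [Γ'.comma]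

theorem length_tableText_le {α : Type} (T : α → Value) (l : List α) {W : ℕ}
    (hT : ∀ w, (T w).encode.length ≤ W) : (tableText T l).length ≤ l.length * (W + 1) := by
  induction l with
  | nil => simp [tableText]
  | cons a l ih =>
    have := hT a
    simp only [tableText, List.flatMap_cons, List.length_append, List.length_cons,
      List.length_nil] at ih ⊢
    linarith

/-- The value of a vertex computed from a row of the edge table and a table of values. -/
def rowValue {α : Type} (mx : Bool) (e : α → Option Constraint) (T : α → Value) (l : List α) :
    Value :=
  l.foldl (fun a w => accumulate mx (T w).pred a (e w)) (Value.start mx)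

theorem length_accumulate_le {mx : Bool} {w a : Value} {e : Option Constraint} {W : ℕ}
    (hw : w.encode.length ≤ W) (ha : a.encode.length ≤ W)
    (he : (Instance.encodeEntry e).length ≤ W) : (accumulate mx w a e).encode.length ≤ W := by
  rcases e with _ | c
  · exact ha
  · have hb := c.length_bound_le mx
    rw [encodeEntry_some] at he
    simp only [List.length_cons, List.length_map] at he
    exact Value.length_encode_select_le (Value.length_encode_select_le hw (by omega)) ha

theorem length_start_le (b : Bool) : (Value.start b).encode.length ≤ 1 := by
  cases b <;> simp [Value.start, Value.encode]

theorem length_rowValue_le {α : Type} (mx : Bool) (e : α → Option Constraint) (T : α → Value)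
    (l : List α) {W : ℕ} (hW : 1 ≤ W) (hT : ∀ w, (T w).encode.length ≤ W)
    (he : ∀ w, (Instance.encodeEntry (e w)).length ≤ W) :
    (rowValue mx e T l).encode.length ≤ W := by
  induction l using List.reverseRecOn with
  | nil => exact (length_start_le mx).trans hW
  | append_singleton l a ih =>
    simp only [rowValue, List.foldl_append, List.foldl_cons, List.foldl_nil] at ih ⊢
    exact length_accumulate_le ((Value.length_encode_pred_le _).trans (hT a)) ih (he a)

/-- Read a row of the edge table and the table of values, and update `acc`. -/
def readRow (mx : Bool) : Code :=
  .loop .inp (isNot .comma) fun o => pushOpt .inp2 o ;; readValue ;; readEntry mx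

theorem runs_readRow {α : Type} (s : Store) (mx b : Bool) (e : α → Option Constraint)
    (T : α → Value) (l : List α) (rest : List Γ') {W : ℕ} (hW : 1 ≤ W)
    (hT : ∀ w, (T w).encode.length ≤ W) (he : ∀ w, (Instance.encodeEntry (e w)).length ≤ W) :
    Runs (readRow mx)
      { s with
        inp := rowText e l ++ .ket :: rest, tab := tableText T l, tab2 := [], val := []
        acc := (Value.start mx).encode, bnd := [], t1 := [], t2 := [], flg := [], bad := flag b }
      { s with
        inp := .ket :: rest, inp2 := (rowText e l).reverse ++ s.inp2, tab := []
        tab2 := (tableText T l).reverse, val := [], acc := (rowValue mx e T l).encode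
        bnd := [], t1 := [], t2 := [], flg := [], bad := flag (b || l.any (badEntry mx ∘ e)) }
      (l.length * (69 * W + 82) + 1) := by
  have key := Runs.loop_list (r := .inp) (halts := isNot .comma)
    (f := fun o => pushOpt .inp2 o ;; readValue ;; readEntry mx)
    (fun pre post => { s with
      inp := rowText e post ++ .ket :: rest, inp2 := (rowText e pre).reverse ++ s.inp2
      tab := tableText T post, tab2 := (tableText T pre).reverse, val := []
      acc := (rowValue mx e T pre).encode
      bnd := [], t1 := [], t2 := [], flg := [], bad := flag (b || pre.any (badEntry mx ∘ e)) })
    (69 * W + 81) l ?_ rfl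
  · simp only [List.any_nil, Bool.or_false] at key
    exact key
  · intro pre w post _
    refine ⟨rfl, ?_⟩
    have hnext : ∃ x r, (x = Γ'.comma ∨ x = Γ'.ket) ∧ rowText e post ++ Γ'.ket :: rest = x :: r := by
      cases post with
      | nil => exact ⟨_, _, .inr rfl, rfl⟩
      | cons y post => exact ⟨_, _, .inl rfl, rfl⟩
    obtain ⟨x, r, hx, hr⟩ := hnext
    have h₁ := runs_readValue { s with
      inp := Instance.encodeEntry (e w) ++ x :: r, inp2 := .comma :: ((rowText e pre).reverse ++ s.inp2)
      tab2 := (tableText T pre).reverse, acc := (rowValue mx e T pre).encode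
      bnd := [], t2 := [], flg := [], bad := flag (b || pre.any (badEntry mx ∘ e)) }
      (T w) (tableText T post)
    have h₂ := runs_readEntry { s with
      inp2 := .comma :: ((rowText e pre).reverse ++ s.inp2), tab := tableText T post
      tab2 := .comma :: ((T w).encode.reverse ++ (tableText T pre).reverse) }
      mx (b || pre.any (badEntry mx ∘ e)) (e w) (T w).pred (rowValue mx e T pre) x r hx (he w)
      ((Value.length_encode_pred_le _).trans (hT w)) (length_rowValue_le mx e T pre hW hT he)
    have h₀ : Runs (pushOpt .inp2 (some .comma))
        { s with
          inp := Instance.encodeEntry (e w) ++ x :: r, inp2 := (rowText e pre).reverse ++ s.inp2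
          tab := (T w).encode ++ .comma :: tableText T post, tab2 := (tableText T pre).reverse
          val := [], acc := (rowValue mx e T pre).encode
          bnd := [], t1 := [], t2 := [], flg := [], bad := flag (b || pre.any (badEntry mx ∘ e)) }
        { s with
          inp := Instance.encodeEntry (e w) ++ x :: r
          inp2 := .comma :: ((rowText e pre).reverse ++ s.inp2)
          tab := (T w).encode ++ .comma :: tableText T post, tab2 := (tableText T pre).reverse
          val := [], acc := (rowValue mx e T pre).encode
          bnd := [], t1 := [], t2 := [], flg := [], bad := flag (b || pre.any (badEntry mx ∘ e)) }
        1 := Runs.push _ _ _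
    have h := (h₀.seq (h₁.seq h₂)).mono (t' := 69 * W + 81) (by have := hT w; omega)
    have hstart : rowText e (w :: post) ++ Γ'.ket :: rest =
        .comma :: (Instance.encodeEntry (e w) ++ x :: r) := by
      rw [← hr]
      simp [rowText]
    have htab : tableText T (w :: post) = (T w).encode ++ .comma :: tableText T post := by
      simp [tableText]
    simp only [hstart, htab]
    refine Runs.congr h ?_ le_rfl
    simp [rowText, tableText, ← hr, rowValue, Bool.or_assoc]

/-- Put the value `0` or infinity on `acc`. -/
def startCode (zero : Bool) : Code := if zero then .skip else .push .acc .blank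

theorem runs_startCode (s : Store) (zero : Bool) :
    Runs (startCode zero) { s with acc := [] } { s with acc := (Value.start zero).encode } 1 := by
  cases zero
  · exact Runs.push _ _ _
  · exact Runs.skip

theorem runs_setRes (s : Store) (b : Bool) :
    Runs (.pop .res fun _ => .push .res .blank) { s with res := flag b }
      { s with res := flag true } 2 := by
  cases b <;> exact Runs.pop (Runs.push _ _ _)

/-- Move the value on `acc` to the new table, replacing it by a constant for targets; for the
initial vertex, record on `res` whether the value is positive. Then restore the old table. -/
def finishRow (imp tgt ini : Bool) : Code :=
  (if tgt then clear .acc ;; startCode imp else .skip) ;;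
  (if ini then .pop .res fun _ => .skip else .skip) ;;
  .loop .acc Option.isNone (fun o => pushOpt .new o ;;
    if ini && isPositive o then .pop .res fun _ => .push .res .blank else .skip) ;;
  .push .new .comma ;; move .tab2 .tab

theorem runs_finishRow (s : Store) (imp tgt ini r : Bool) (v : Value) (x : List Γ') {W L : ℕ}
    (hW : 1 ≤ W) (hv : v.encode.length ≤ W) (hx : x.length ≤ L) :
    Runs (finishRow imp tgt ini)
      { s with acc := v.encode, tab := [], tab2 := x.reverse, res := flag r }
      { s with
        acc := [], tab := x, tab2 := []
        new := .comma :: ((if tgt then Value.start imp else v).encode.reverse ++ s.new)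
        res := flag (if ini then (if tgt then Value.start imp else v).positive else r) }
      (6 * W + 2 * L + 10) := by
  set u : Value := if tgt then Value.start imp else v with hu
  have hul : u.encode.length ≤ W := by
    rw [hu]
    split_ifs
    exacts [(length_start_le imp).trans hW, hv]
  have h₁ : Runs (if tgt then clear .acc ;; startCode imp else .skip)
      { s with acc := v.encode, tab := [], tab2 := x.reverse, res := flag r }
      { s with acc := u.encode, tab := [], tab2 := x.reverse, res := flag r } (2 * W + 2) := by
    cases tgt
    · exact Runs.skip.mono (by omega)
    · exact ((runs_clear .acc
        { s with acc := v.encode, tab := [], tab2 := x.reverse, res := flag r }).seq (runs_startCode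
        { s with tab := [], tab2 := x.reverse, res := flag r } imp)).mono
        (by simp only [Store.get]; omega)
  have h₂ : Runs (if ini then .pop .res fun _ => .skip else .skip)
      { s with acc := u.encode, tab := [], tab2 := x.reverse, res := flag r }
      { s with acc := u.encode, tab := [], tab2 := x.reverse, res := flag (!ini && r) } 2 := by
    cases ini
    · exact Runs.skip.mono (by omega)
    · cases r <;> exact Runs.pop Runs.skip
  have h₃ := Runs.loop_list (r := .acc) (halts := Option.isNone)
    (f := fun o => pushOpt .new o ;;
      if ini && isPositive o then .pop .res fun _ => .push .res .blank else .skip)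
    (fun pre post => { s with
      acc := post, tab := [], tab2 := x.reverse, new := pre.reverse ++ s.new
      res := flag (!ini && r || ini && pre.any fun a => isPositive (some a)) })
    3 u.encode ?_ rfl
  · have h₄ : Runs (.push .new .comma)
        { s with
          acc := [], tab := [], tab2 := x.reverse, new := u.encode.reverse ++ s.new
          res := flag (!ini && r || ini && u.positive) }
        { s with
          acc := [], tab := [], tab2 := x.reverse, new := .comma :: (u.encode.reverse ++ s.new)
          res := flag (!ini && r || ini && u.positive) } 1 := Runs.push _ _ _
    have h₅ : Runs (move .tab2 .tab)
        { s with
          acc := [], tab := [], tab2 := x.reverse, new := .comma :: (u.encode.reverse ++ s.new)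
          res := flag (!ini && r || ini && u.positive) }
        { s with
          acc := [], tab := x, tab2 := [], new := .comma :: (u.encode.reverse ++ s.new)
          res := flag (!ini && r || ini && u.positive) } (2 * x.length + 1) :=
      (runs_move (by decide) _).congr (by simp [Store.set, Store.get]) (by simp [Store.get])
    have h₃' := h₃.congr (s'' := { s with
          acc := [], tab := [], tab2 := x.reverse, new := u.encode.reverse ++ s.new
          res := flag (!ini && r || ini && u.positive) }) (by simp [Value.positive]) le_rfl
    refine Runs.congr (h₁.seq ((h₂.congr (by simp) le_rfl).seq (h₃'.seq (h₄.seq h₅)))) ?_ ?_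
    · cases ini <;> simp
    · omega
  · intro pre a post _
    refine ⟨rfl, ?_⟩
    refine Runs.mono (Runs.seq (n := 2) (Runs.push _ _ _) ?_) le_rfl
    generalize hA : (!ini && r || ini && pre.any fun a => isPositive (some a)) = A
    by_cases hp : (ini && isPositive (some a)) = true
    · have hfin : (!ini && r || ini && (pre ++ [a]).any fun a => isPositive (some a)) = true := by
        simp_all
      rw [hfin]
      simp only [Store.get, List.head?_cons, hp, if_true]
      refine Runs.congr (runs_setRes { s with
        acc := post, tab := [], tab2 := x.reverse, new := a :: (pre.reverse ++ s.new) } A) ?_ le_rfl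
      simp
    · have hfin : (!ini && r || ini && (pre ++ [a]).any fun a => isPositive (some a)) = A := by
        rw [← hA]
        cases ini <;> simp_all
      rw [hfin]
      simp only [Store.get, List.head?_cons, hp]
      exact Runs.skip.congr (by simp [Store.set]) (by omega)

/-! ### Rounds -/

namespace Instance

variable (I : Instance) (imp : Bool)

/-- Does the owner of the vertex aim at a large value? This is Player 1 in declining games and
Player 2 in improving games (`imp`). -/
def maximizes (v : Fin I.n) : Bool := I.ownedBy1 v ^^ imp

/-- One round of value iteration. -/
def next (T : Fin I.n → Value) (v : Fin I.n) : Value :=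
  if I.isTarget v then Value.start imp
  else rowValue (I.maximizes imp v) (I.edge v) T (List.finRange I.n)

/-- Does some edge violate the condition of declining, respectively improving, games? -/
def isBad : Bool :=
  (List.finRange I.n).any fun v =>
    (List.finRange I.n).any (badEntry (I.maximizes imp v) ∘ I.edge v)

end Instance

/-- Process the description of a vertex. -/
def vertexCode (imp : Bool) (o : Option Γ') : Code :=
  pushOpt .inp2 o ;;
  .pop .inp fun o₁ => pushOpt .inp2 o₁ ;;
  .pop .inp fun o₂ => pushOpt .inp2 o₂ ;;
  .pop .inp fun o₃ => pushOpt .inp2 o₃ ;;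
  startCode (isOne o₁ ^^ imp) ;; readRow (isOne o₁ ^^ imp) ;;
  finishRow imp (isOne o₂) (isOne o₃) ;; .pop .inp (pushOpt .inp2)

/-- Replace the table of values by the next one. -/
def roundCode (imp : Bool) : Code :=
  .loop .inp Option.isNone (vertexCode imp) ;; move .inp2 .inp ;; clear .tab ;; move .new .tab

theorem isOne_bit (b : Bool) : isOne (some (.bit b)) = b := by cases b <;> rfl

theorem encodeVertex_eq (I : Instance) (v : Fin I.n) :
    I.encodeVertex v = .bra :: .bit (I.ownedBy1 v) :: .bit (I.isTarget v) ::
      .bit (decide (v = I.init)) :: (rowText (I.edge v) (List.finRange I.n) ++ [.ket]) := by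
  simp [Instance.encodeVertex, rowText]

theorem runs_vertexCode (s : Store) (I : Instance) (imp b r : Bool) (T : Fin I.n → Value)
    (v : Fin I.n) (rest : List Γ') {W : ℕ} (hW : 1 ≤ W) (hn : I.n ≤ W)
    (hT : ∀ w, (T w).encode.length ≤ W)
    (he : ∀ w, (Instance.encodeEntry (I.edge v w)).length ≤ W) :
    Runs (vertexCode imp (some .bra))
      { s with
        inp := (I.encodeVertex v).tail ++ rest, tab := tableText T (List.finRange I.n), tab2 := []
        acc := [], val := [], bnd := [], t1 := [], t2 := [], flg := [], res := flag r
        bad := flag b }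
      { s with
        inp := rest, inp2 := (I.encodeVertex v).reverse ++ s.inp2
        tab := tableText T (List.finRange I.n), tab2 := []
        new := .comma :: ((I.next imp T v).encode.reverse ++ s.new)
        acc := [], val := [], bnd := [], t1 := [], t2 := [], flg := []
        res := flag (if v = I.init then (I.next imp T v).positive else r)
        bad := flag (b || (List.finRange I.n).any (badEntry (I.maximizes imp v) ∘ I.edge v)) }
      (71 * W ^ 2 + 90 * W + 30) := by
  rw [encodeVertex_eq]
  set mx := I.maximizes imp v with hmx
  set ini := decide (v = I.init) with hini
  have hmx' : (isOne (some (.bit (I.ownedBy1 v))) ^^ imp) = mx := by rw [isOne_bit, hmx]; rfl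
  set inp2 := .bit ini :: .bit (I.isTarget v) :: .bit (I.ownedBy1 v) :: .bra :: s.inp2 with hinp2
  set row := rowText (I.edge v) (List.finRange I.n) with hrow
  have h₁ := runs_startCode { s with
    inp := row ++ .ket :: rest, inp2 := inp2, tab := tableText T (List.finRange I.n), tab2 := []
    val := [], bnd := [], t1 := [], t2 := [], flg := [], res := flag r, bad := flag b } mx
  have h₂ := runs_readRow { s with inp2 := inp2, res := flag r } mx b (I.edge v) T
    (List.finRange I.n) rest hW hT he
  have h₃ := runs_finishRow { s with
    inp := .ket :: rest, inp2 := row.reverse ++ inp2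
    val := [], bnd := [], t1 := [], t2 := [], flg := []
    bad := flag (b || (List.finRange I.n).any (badEntry mx ∘ I.edge v)) }
    imp (I.isTarget v) ini r (rowValue mx (I.edge v) T (List.finRange I.n))
    (tableText T (List.finRange I.n)) hW (length_rowValue_le _ _ _ _ hW hT he)
    (length_tableText_le T (List.finRange I.n) hT)
  have h₄ : Runs (.pop .inp (pushOpt .inp2))
    { s with
      inp := .ket :: rest, inp2 := row.reverse ++ inp2, tab := tableText T (List.finRange I.n)
      tab2 := [], new := .comma :: ((I.next imp T v).encode.reverse ++ s.new)
      acc := [], val := [], bnd := [], t1 := [], t2 := [], flg := []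
      res := flag (if v = I.init then (I.next imp T v).positive else r)
      bad := flag (b || (List.finRange I.n).any (badEntry mx ∘ I.edge v)) }
    { s with
      inp := rest, inp2 := .ket :: (row.reverse ++ inp2), tab := tableText T (List.finRange I.n)
      tab2 := [], new := .comma :: ((I.next imp T v).encode.reverse ++ s.new)
      acc := [], val := [], bnd := [], t1 := [], t2 := [], flg := []
      res := flag (if v = I.init then (I.next imp T v).positive else r)
      bad := flag (b || (List.finRange I.n).any (badEntry mx ∘ I.edge v)) } 2 :=
    Runs.pop (Runs.push _ _ _)
  have h₃' := h₃.congr (s'' := { s with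
      inp := .ket :: rest, inp2 := row.reverse ++ inp2, tab := tableText T (List.finRange I.n)
      tab2 := [], new := .comma :: ((I.next imp T v).encode.reverse ++ s.new)
      acc := [], val := [], bnd := [], t1 := [], t2 := [], flg := []
      res := flag (if v = I.init then (I.next imp T v).positive else r)
      bad := flag (b || (List.finRange I.n).any (badEntry mx ∘ I.edge v)) })
      (by simp [Instance.next, hini, hmx]) le_rfl
  have hcore := h₁.seq (h₂.seq (h₃'.seq h₄))
  rw [show (startCode mx ;; readRow mx ;; finishRow imp (I.isTarget v) ini ;;
      .pop .inp (pushOpt .inp2)) = (startCode (isOne (some (.bit (I.ownedBy1 v))) ^^ imp) ;;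
      readRow (isOne (some (.bit (I.ownedBy1 v))) ^^ imp) ;;
      finishRow imp (isOne (some (.bit (I.isTarget v)))) (isOne (some (.bit ini))) ;;
      .pop .inp (pushOpt .inp2)) by rw [hmx', isOne_bit, isOne_bit]] at hcore
  rw [show ((.bra :: .bit (I.ownedBy1 v) :: .bit (I.isTarget v) :: .bit ini ::
      (row ++ [.ket]) : List Γ').tail ++ rest) =
      .bit (I.ownedBy1 v) :: .bit (I.isTarget v) :: .bit ini :: (row ++ .ket :: rest) by simp]
  refine Runs.congr ((Runs.push _ _ _).seq (Runs.pop ((Runs.push _ _ _).seq (Runs.pop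
    ((Runs.push _ _ _).seq (Runs.pop ((Runs.push _ _ _).seq hcore))))))) ?_ ?_
  · simp [hinp2]
  · have h₅ : I.n * (69 * W + 82) ≤ W * (69 * W + 82) := Nat.mul_le_mul_right _ hn
    have h₆ : I.n * (W + 1) ≤ W * (W + 1) := Nat.mul_le_mul_right _ hn
    simp only [List.length_finRange]
    nlinarith

/-- The time for one round, in terms of the length of the input. -/
def roundTime (N : ℕ) : ℕ := 71 * N ^ 3 + 98 * N ^ 2 + 40 * N + 10

theorem length_le_length_encode (I : Instance) : I.n ≤ I.encode.length := by
  have : ∀ l : List (Fin I.n), l.length ≤ (l.flatMap I.encodeVertex).length := by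
    intro l
    induction l with
    | nil => simp
    | cons v l ih =>
      simp only [List.length_cons, List.flatMap_cons, List.length_append, encodeVertex_eq]
      omega
  have h := this (List.finRange I.n)
  rwa [List.length_finRange] at h

theorem length_le_length_flatMap {α β : Type} {l : List α} (f : α → List β) {a : α} (h : a ∈ l) :
    (f a).length ≤ (l.flatMap f).length := by
  obtain ⟨s, t, rfl⟩ := List.append_of_mem h
  simp only [List.flatMap_append, List.flatMap_cons, List.length_append]
  omega

theorem length_encodeEntry_le (I : Instance) (v w : Fin I.n) :
    (Instance.encodeEntry (I.edge v w)).length ≤ I.encode.length := by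
  have h₁ : (I.encodeVertex v).length ≤ I.encode.length :=
    length_le_length_flatMap _ (List.mem_finRange v)
  have h₂ : (Γ'.comma :: Instance.encodeEntry (I.edge v w)).length ≤ (I.encodeVertex v).length := by
    have h₃ : (Γ'.comma :: Instance.encodeEntry (I.edge v w)).length ≤
        (rowText (I.edge v) (List.finRange I.n)).length :=
      length_le_length_flatMap (fun w => Γ'.comma :: Instance.encodeEntry (I.edge v w))
        (List.mem_finRange w)
    rw [encodeVertex_eq]
    simp only [List.length_cons, List.length_append] at h₃ ⊢
    omega
  simp only [List.length_cons] at h₂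
  omega

theorem length_next_le (I : Instance) (imp : Bool) (T : Fin I.n → Value)
    (hT : ∀ w, (T w).encode.length ≤ I.encode.length) (v : Fin I.n) :
    (I.next imp T v).encode.length ≤ I.encode.length := by
  have hN : 1 ≤ I.encode.length := (Fin.pos I.init).trans_le (length_le_length_encode I)
  unfold Instance.next
  split_ifs
  · exact (length_start_le imp).trans hN
  · exact length_rowValue_le _ _ _ _ hN hT (length_encodeEntry_le I v)

theorem runs_roundCode (I : Instance) (imp b r : Bool) (T : Fin I.n → Value) (c : List Γ')
    (hT : ∀ w, (T w).encode.length ≤ I.encode.length) :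
    Runs (roundCode imp)
      { inp := I.encode, tab := tableText T (List.finRange I.n), res := flag r, bad := flag b
        clk := c }
      { inp := I.encode, tab := tableText (I.next imp T) (List.finRange I.n)
        res := flag (I.next imp T I.init).positive, bad := flag (b || I.isBad imp)
        clk := c } (roundTime I.encode.length) := by
  have hn := length_le_length_encode I
  have hN : 1 ≤ I.encode.length := (Fin.pos I.init).trans_le hn
  set N := I.encode.length with hNdef
  have key := Runs.loop_list (r := .inp) (halts := Option.isNone) (f := vertexCode imp)
    (fun pre post =>
      { inp := post.flatMap I.encodeVertex, inp2 := (pre.flatMap I.encodeVertex).reverse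
        tab := tableText T (List.finRange I.n), new := (tableText (I.next imp T) pre).reverse
        res := flag (if I.init ∈ pre then (I.next imp T I.init).positive else r)
        bad := flag (b || pre.any fun v =>
          (List.finRange I.n).any (badEntry (I.maximizes imp v) ∘ I.edge v))
        clk := c })
    (71 * N ^ 2 + 90 * N + 30) (List.finRange I.n) ?_ rfl
  · simp only [List.mem_finRange, if_true] at key
    have h₂ : Runs (move .inp2 .inp)
        { inp2 := I.encode.reverse, tab := tableText T (List.finRange I.n)
          new := (tableText (I.next imp T) (List.finRange I.n)).reverse
          res := flag (I.next imp T I.init).positive, bad := flag (b || I.isBad imp)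
          clk := c }
        { inp := I.encode, tab := tableText T (List.finRange I.n)
          new := (tableText (I.next imp T) (List.finRange I.n)).reverse
          res := flag (I.next imp T I.init).positive, bad := flag (b || I.isBad imp)
          clk := c } (2 * N + 1) :=
      (runs_move (by decide) _).congr (by simp [Store.set, Store.get])
        (by simp [Store.get, hNdef])
    have h₃ := runs_clear .tab
        { inp := I.encode, tab := tableText T (List.finRange I.n)
          new := (tableText (I.next imp T) (List.finRange I.n)).reverse
          res := flag (I.next imp T I.init).positive, bad := flag (b || I.isBad imp)
          clk := c }
    have h₄ : Runs (move .new .tab)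
        { inp := I.encode
          new := (tableText (I.next imp T) (List.finRange I.n)).reverse
          res := flag (I.next imp T I.init).positive, bad := flag (b || I.isBad imp)
          clk := c }
        { inp := I.encode, tab := tableText (I.next imp T) (List.finRange I.n)
          res := flag (I.next imp T I.init).positive, bad := flag (b || I.isBad imp)
          clk := c } _ :=
      (runs_move (by decide) _).congr (by simp [Store.set, Store.get]) le_rfl
    simp only [List.not_mem_nil, if_false, List.any_nil, Bool.or_false] at key
    refine Runs.mono (key.seq (h₂.seq (h₃.seq h₄))) ?_
    have l₁ := length_tableText_le T (List.finRange I.n) hT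
    have l₂ := length_tableText_le (I.next imp T) (List.finRange I.n) (length_next_le I imp T hT)
    rw [← hNdef] at l₂
    simp only [Store.get, List.length_reverse, List.length_finRange, roundTime] at l₁ l₂ ⊢
    have h₅ : I.n * (71 * N ^ 2 + 90 * N + 30 + 1) ≤ N * (71 * N ^ 2 + 90 * N + 30 + 1) :=
      Nat.mul_le_mul_right _ hn
    have h₆ : I.n * (N + 1) ≤ N * (N + 1) := Nat.mul_le_mul_right _ hn
    have e₁ : N * (71 * N ^ 2 + 90 * N + 30 + 1) = 71 * N ^ 3 + 90 * N ^ 2 + 31 * N := by ring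
    have e₂ : N * (N + 1) = N ^ 2 + N := by ring
    omega
  · intro pre v post _
    have hv := runs_vertexCode
      { inp2 := (pre.flatMap I.encodeVertex).reverse
        new := (tableText (I.next imp T) pre).reverse, clk := c } I imp
      (b || pre.any fun v => (List.finRange I.n).any (badEntry (I.maximizes imp v) ∘ I.edge v))
      (if I.init ∈ pre then (I.next imp T I.init).positive else r) T v
      (post.flatMap I.encodeVertex) hN hn hT (length_encodeEntry_le I v)
    have hinp : (v :: post).flatMap I.encodeVertex =
        .bra :: ((I.encodeVertex v).tail ++ post.flatMap I.encodeVertex) := by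
      rw [List.flatMap_cons, encodeVertex_eq]
      simp
    simp only [hinp]
    refine ⟨rfl, hv.congr ?_ le_rfl⟩
    have hres : (if v = I.init then (I.next imp T v).positive else
        if I.init ∈ pre then (I.next imp T I.init).positive else r) =
        if I.init ∈ pre ++ [v] then (I.next imp T I.init).positive else r := by
      by_cases h : v = I.init
      · subst h
        simp
      · have : I.init ∈ pre ++ [v] ↔ I.init ∈ pre := by simp [Ne.symm h]
        simp [h, this]
    rw [hres]
    simp [tableText, Bool.or_assoc]

/-! ### The decision procedure -/

/-- Replace finite values by `0`. -/
def Value.collapse : Value → Value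
  | none => none
  | some _ => some []

/-- Put a table on `tab` in which all values are `0` or all values are infinite. -/
def tableCode (zero : Bool) : Code :=
  .loop .inp Option.isNone (fun o => pushOpt .inp2 o ;;
    if o = some .ket then
      .push .tab .comma ;; (if zero then .skip else .push .tab .blank)
    else .skip) ;;
  move .inp2 .inp

/-- Perform as many rounds as the input has symbols. -/
def phaseCode (imp : Bool) : Code :=
  .loop .inp Option.isNone (fun o => pushOpt .inp2 o ;; pushOpt .clk o) ;; move .inp2 .inp ;;
  .loop .clk Option.isNone (fun _ => roundCode imp)

/-- Replace all finite values in the table by `0`. -/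
def collapseCode : Code :=
  .loop .tab Option.isNone (fun o => match o with
    | some (.bit _) => .skip
    | o => pushOpt .new o) ;;
  move .new .tab

/-- Compute the answer, and empty all other stacks. -/
def answerCode (imp : Bool) : Code :=
  clear .inp ;; clear .tab ;;
  .pop .bad fun b => .pop .res fun r =>
    .push .res (.bit (b.isNone && (r.isSome ^^ imp)))

/-- The decision procedure for declining games, and for improving games (`imp`). -/
def decisionCode (imp : Bool) : Code :=
  tableCode (!imp) ;; phaseCode imp ;; (if imp then collapseCode ;; phaseCode imp else .skip) ;;
  answerCode imp

theorem count_ket_encode (I : Instance) : I.encode.count .ket = I.n := by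
  have hentry : ∀ e, (Instance.encodeEntry e).count .ket = 0 := by
    intro e
    rcases e with _ | c
    · rfl
    · simp [encodeEntry_some, List.count_eq_zero]
  have hrow : ∀ (v : Fin I.n) (l : List (Fin I.n)), (rowText (I.edge v) l).count .ket = 0 := by
    intro v l
    induction l with
    | nil => rfl
    | cons w l ih =>
      simp only [rowText, List.flatMap_cons, List.count_append, List.count_cons, hentry] at ih ⊢
      simp [ih]
  have hvertex : ∀ v, (I.encodeVertex v).count .ket = 1 := by
    intro v
    simp [encodeVertex_eq, hrow]
  have : ∀ l : List (Fin I.n), (l.flatMap I.encodeVertex).count .ket = l.length := by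
    intro l
    induction l with
    | nil => rfl
    | cons v l ih => simp [List.flatMap_cons, hvertex, ih]; omega
  have h := this (List.finRange I.n)
  rwa [List.length_finRange] at h

theorem tableText_const {α : Type} (v : Value) (l : List α) :
    tableText (fun _ => v) l = (List.replicate l.length (v.encode ++ [.comma])).flatten := by
  induction l with
  | nil => rfl
  | cons a l ih => simp_all [tableText, List.replicate_succ]

theorem runs_tableCode (I : Instance) (zero : Bool) :
    Runs (tableCode zero) { inp := I.encode }
      { inp := I.encode, tab := tableText (fun _ => Value.start zero) (List.finRange I.n) }
      (7 * I.encode.length + 2) := by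
  set text : List Γ' := (Value.start zero).encode ++ [.comma] with htext
  have key := Runs.loop_list (r := .inp) (halts := Option.isNone)
    (f := fun o => pushOpt .inp2 o ;;
      if o = some .ket then
        .push .tab .comma ;; (if zero then .skip else .push .tab .blank)
      else .skip)
    (fun pre post => { inp := post, inp2 := pre.reverse
                       tab := (List.replicate (pre.count .ket) text).flatten })
    4 I.encode ?_ rfl
  · rw [count_ket_encode] at key
    refine Runs.congr (key.seq (runs_move (by decide) _)) ?_ ?_
    · simp [Store.set, Store.get, tableText_const, htext]
    · simp [Store.get]
      omega
  · intro pre a post _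
    refine ⟨rfl, Runs.mono (Runs.seq (n := 2) (Runs.push _ _ _) ?_) (by omega)⟩
    by_cases ha : a = .ket
    · subst ha
      have hc : (pre ++ [Γ'.ket]).count .ket = pre.count .ket + 1 := by simp
      have h2 : (List.replicate ((pre ++ [Γ'.ket]).count .ket) text).flatten =
          text ++ (List.replicate (pre.count .ket) text).flatten := by
        rw [hc, List.replicate_succ, List.flatten_cons]
      rw [h2]
      cases zero
      · exact ((Runs.push _ _ _).seq (Runs.push _ _ _)).congr
          (by simp [Store.set, Store.get, htext, Value.start, Value.encode]) le_rfl
      · exact ((Runs.push _ _ _).seq Runs.skip).congr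
          (by simp [Store.set, Store.get, htext, Value.start, Value.encode]) le_rfl
    · have hc : (pre ++ [a]).count .ket = pre.count .ket := by
        simp [List.count_append, ha]
      rw [hc]
      simp only [Store.get, List.head?_cons, Option.some.injEq, ha, if_false]
      exact Runs.skip.congr (by simp [Store.set]) (by omega)

/-- The time for one phase, in terms of the length of the input. -/
def phaseTime (N : ℕ) : ℕ := N * (roundTime N + 1) + 5 * N + 3

theorem length_iterate_next_le (I : Instance) (imp : Bool) (T : Fin I.n → Value)
    (hT : ∀ w, (T w).encode.length ≤ I.encode.length) (k : ℕ) (v : Fin I.n) :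
    ((I.next imp)^[k] T v).encode.length ≤ I.encode.length := by
  induction k generalizing v with
  | zero => exact hT v
  | succ k ih =>
    rw [Function.iterate_succ_apply']
    exact length_next_le I imp _ ih v

theorem runs_phaseCode (I : Instance) (imp b r : Bool) (T : Fin I.n → Value)
    (hT : ∀ w, (T w).encode.length ≤ I.encode.length) :
    Runs (phaseCode imp)
      { inp := I.encode, tab := tableText T (List.finRange I.n), res := flag r, bad := flag b }
      { inp := I.encode
        tab := tableText ((I.next imp)^[I.encode.length] T) (List.finRange I.n)
        res := flag ((I.next imp)^[I.encode.length] T I.init).positive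
        bad := flag (b || I.isBad imp) } (phaseTime I.encode.length) := by
  have hN : 1 ≤ I.encode.length := (Fin.pos I.init).trans_le (length_le_length_encode I)
  set tab := tableText T (List.finRange I.n) with htab
  have h₁ := Runs.loop_list (r := .inp) (halts := Option.isNone)
    (f := fun o => pushOpt .inp2 o ;; pushOpt .clk o)
    (fun pre post => { inp := post, inp2 := pre.reverse, clk := pre.reverse, tab := tab
                       res := flag r, bad := flag b })
    2 I.encode ?_ rfl
  · have h₂ : Runs (move .inp2 .inp)
        { inp2 := I.encode.reverse, clk := I.encode.reverse, tab := tab, res := flag r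
          bad := flag b }
        { inp := I.encode, clk := I.encode.reverse, tab := tab, res := flag r, bad := flag b }
        (2 * I.encode.length + 1) :=
      (runs_move (by decide) _).congr (by simp [Store.set, Store.get]) (by simp [Store.get])
    have h₃ := Runs.loop_list (r := .clk) (halts := Option.isNone) (f := fun _ => roundCode imp)
      (fun pre post => {
        inp := I.encode, clk := post
        tab := tableText ((I.next imp)^[pre.length] T) (List.finRange I.n)
        res := flag (if pre = [] then r else ((I.next imp)^[pre.length] T I.init).positive)
        bad := flag (b || !pre.isEmpty && I.isBad imp) })
      (roundTime I.encode.length) I.encode.reverse ?_ rfl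
    · have hne : I.encode ≠ [] := by
        intro h
        simp [h] at hN
      simp only [if_true, List.isEmpty_nil, Bool.not_true, Bool.false_and, Bool.or_false] at h₃
      refine Runs.congr (h₁.seq (h₂.seq h₃)) ?_ ?_
      · have hne' : I.encode.isEmpty = false := by simpa using hne
        simp [hne, hne']
      · simp only [List.length_reverse, phaseTime]
        omega
    · intro pre a post _
      refine ⟨rfl, ?_⟩
      have := runs_roundCode I imp (b || !pre.isEmpty && I.isBad imp)
        (if pre = [] then r else ((I.next imp)^[pre.length] T I.init).positive)
        ((I.next imp)^[pre.length] T) post (length_iterate_next_le I imp T hT _)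
      refine this.congr ?_ le_rfl
      have hb : (b || !pre.isEmpty && I.isBad imp || I.isBad imp) = (b || I.isBad imp) := by
        cases I.isBad imp <;> simp
      have he : (pre ++ [a]).isEmpty = false := by simp
      rw [hb]
      simp [Function.iterate_succ_apply', he]
  · intro pre a post _
    exact ⟨rfl, Runs.congr ((Runs.push _ _ _).seq (Runs.push _ _ _))
      (by simp [Store.set, Store.get]) le_rfl⟩

theorem filter_tableText {α : Type} (T : α → Value) (l : List α) :
    (tableText T l).filter (fun a => isNotBit (some a)) =
      tableText (fun w => (T w).collapse) l := by
  induction l with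
  | nil => rfl
  | cons a l ih =>
    simp only [tableText, List.flatMap_cons, List.filter_append] at ih ⊢
    rw [ih]
    rcases T a with _ | x
    · rfl
    · have hx : (x.map Γ'.bit).filter (fun a => isNotBit (some a)) = [] := by
        rw [List.filter_map]
        simp [Function.comp_def, isNotBit]
      rw [Value.encode, hx]
      rfl

theorem runs_collapseCode {α : Type} (s : Store) (T : α → Value) (l : List α) :
    Runs collapseCode { s with tab := tableText T l, new := [] }
      { s with tab := tableText (fun w => (T w).collapse) l, new := [] }
      (4 * (tableText T l).length + 2) := by
  have key := Runs.loop_list (r := .tab) (halts := Option.isNone)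
    (f := fun o => match o with
      | some (.bit _) => .skip
      | o => pushOpt .new o)
    (fun pre post => { s with
      tab := post, new := (pre.filter fun a => isNotBit (some a)).reverse })
    1 (tableText T l) ?_ rfl
  · refine Runs.congr (key.seq (runs_move (by decide) _)) ?_ ?_
    · simp [Store.set, Store.get, filter_tableText]
    · have := List.length_filter_le (fun a => isNotBit (some a)) (tableText T l)
      simp only [Store.get, List.length_reverse]
      omega
  · intro pre a post _
    refine ⟨rfl, ?_⟩
    cases a <;> simp only [List.filter_append, List.reverse_append]
    case bit => exact Runs.skip
    all_goals exact Runs.push _ _ _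

theorem runs_answerCode (x t : List Γ') (imp b r : Bool) :
    Runs (answerCode imp) { inp := x, tab := t, res := flag r, bad := flag b }
      { res := [.bit (!b && (r ^^ imp))] } (2 * x.length + 2 * t.length + 5) := by
  refine Runs.congr (Runs.seq (runs_clear .inp _) (Runs.seq (runs_clear .tab _)
    (Runs.pop (Runs.pop (Runs.push _ _ _))))) ?_ ?_
  · cases b <;> cases r <;> simp [Store.set, Store.get, flag]
  · simp [Store.get, Store.set]
    omega

namespace Instance

variable (I : Instance)

/-- The final table of values of a declining game. -/
def decliningTable : Fin I.n → Value :=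
  (I.next false)^[I.encode.length] fun _ => Value.start true

/-- The final table of values of an improving game. -/
def improvingTable : Fin I.n → Value :=
  (I.next true)^[I.encode.length] fun w =>
    ((I.next true)^[I.encode.length] (fun _ => Value.start false) w).collapse

/-- The final table of values. -/
def finalTable (imp : Bool) : Fin I.n → Value :=
  if imp then I.improvingTable else I.decliningTable

end Instance

/-- The running time of the decision procedure, in terms of the length of the input. -/
def decisionTime (N : ℕ) : ℕ := 2 * phaseTime N + 6 * (N * (N + 1)) + 9 * N + 10

theorem Value.length_encode_collapse_le (v : Value) :
    v.collapse.encode.length ≤ v.encode.length := by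
  rcases v with _ | l <;> simp [collapse, encode]

theorem runs_decisionCode (I : Instance) (imp : Bool) :
    Runs (decisionCode imp) { inp := I.encode }
      { res := [.bit (!I.isBad imp && ((I.finalTable imp I.init).positive ^^ imp))] }
      (decisionTime I.encode.length) := by
  have hn := length_le_length_encode I
  have hN : 1 ≤ I.encode.length := (Fin.pos I.init).trans_le hn
  have hstart : ∀ w : Fin I.n, ((fun _ => Value.start (!imp)) w : Value).encode.length ≤
      I.encode.length := fun w => (length_start_le _).trans hN
  have h₁ := runs_tableCode I (!imp)
  have h₂ := runs_phaseCode I imp false false _ hstart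
  set T₁ := (I.next imp)^[I.encode.length] fun _ => Value.start (!imp) with hT₁
  have hT₁l := length_iterate_next_le I imp _ hstart I.encode.length
  have hTl : ∀ w, (I.finalTable imp w).encode.length ≤ I.encode.length := by
    intro w
    cases imp
    · exact hT₁l w
    · exact length_iterate_next_le I true _
        (fun w => (Value.length_encode_collapse_le _).trans (hT₁l w)) _ w
  have h₃ : Runs (if imp then collapseCode ;; phaseCode imp else .skip)
      { inp := I.encode, tab := tableText T₁ (List.finRange I.n)
        res := flag (T₁ I.init).positive, bad := flag (false || I.isBad imp) }
      { inp := I.encode, tab := tableText (I.finalTable imp) (List.finRange I.n)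
        res := flag (I.finalTable imp I.init).positive, bad := flag (I.isBad imp) }
      (4 * (I.encode.length * (I.encode.length + 1)) + 2 + phaseTime I.encode.length) := by
    cases imp
    · exact Runs.skip.mono (by omega)
    · have hc := runs_collapseCode { inp := I.encode, res := flag (T₁ I.init).positive
                                     bad := flag (false || I.isBad true) } T₁ (List.finRange I.n)
      have hp := runs_phaseCode I true (false || I.isBad true) (T₁ I.init).positive
        (fun w => (T₁ w).collapse) fun w => (Value.length_encode_collapse_le _).trans (hT₁l w)
      refine Runs.congr (hc.seq hp) ?_ ?_
      · simp [Instance.finalTable, Instance.improvingTable, hT₁]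
      · have l₁ := length_tableText_le T₁ (List.finRange I.n) hT₁l
        rw [List.length_finRange] at l₁
        have := Nat.mul_le_mul_right (I.encode.length + 1) hn
        omega
  have h₄ := runs_answerCode I.encode (tableText (I.finalTable imp) (List.finRange I.n)) imp
    (I.isBad imp) (I.finalTable imp I.init).positive
  refine Runs.mono (h₁.seq (h₂.seq (h₃.seq h₄))) ?_
  have l₁ := length_tableText_le (I.finalTable imp) (List.finRange I.n) hTl
  rw [List.length_finRange] at l₁
  have := Nat.mul_le_mul_right (I.encode.length + 1) hn
  simp only [decisionTime]
  omega

/-- The decision procedure shows that its answer is computable in polynomial time. -/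
theorem inP_of_finalTable (L : Instance → Prop) (imp : Bool)
    (h : ∀ I, L I ↔ I.isBad imp = false ∧ ((I.finalTable imp I.init).positive ^^ imp) = true) :
    InP Instance.encode L := by
  have hinit : ∀ (r : Reg) (l : List Γ'), (Store.set {} r l).get =
      Function.update (fun _ => []) r l := by
    intro r l
    rw [Store.get_set]
    congr 1
    funext k
    cases k <;> rfl
  let X : Polynomial ℕ := Polynomial.X
  let round : Polynomial ℕ := 71 * X ^ 3 + 98 * X ^ 2 + 40 * X + 10
  let phase : Polynomial ℕ := X * (round + 1) + 5 * X + 3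
  refine Prog.inP_of_exec Instance.encode L (decisionCode imp) .inp .res (.bit true)
    (2 * phase + 6 * (X * (X + 1)) + 9 * X + 10) fun I => ?_
  obtain ⟨n, hn, hx⟩ := runs_decisionCode I imp
  refine ⟨n, .bit (!I.isBad imp && ((I.finalTable imp I.init).positive ^^ imp)), ?_, ?_, ?_⟩
  · rw [h I]
    simp
  · simpa [X, phase, round, decisionTime, phaseTime, roundTime] using hn
  · rw [← hinit, ← hinit]
    exact hx

/-! ### Reachability games: attractors and winning strategies -/

namespace ReachGame

variable {X : Type} (G : ReachGame X)

/-- The positions from which Player 1 can enforce, in at most `k` moves, that the target is visited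
or that Player 2 is stuck. -/
inductive Attr : ℕ → X → Prop
  | target {k x} : x ∈ G.target → Attr k x
  | own {k x y} : x ∈ G.V₁ → G.edge x y → Attr k y → Attr (k + 1) x
  | opp {k x} : x ∉ G.V₁ → (∀ y, G.edge x y → Attr k y) → Attr (k + 1) x

variable {G}

theorem Attr.mono {k l : ℕ} {x : X} (h : G.Attr k x) (hkl : k ≤ l) : G.Attr l x := by
  induction h generalizing l with
  | target h => exact .target h
  | own h₁ h₂ _ ih =>
    obtain ⟨l, rfl⟩ : ∃ l', l = l' + 1 := ⟨l - 1, by omega⟩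
    exact .own h₁ h₂ (ih (by omega))
  | opp h₁ _ ih =>
    obtain ⟨l, rfl⟩ : ∃ l', l = l' + 1 := ⟨l - 1, by omega⟩
    exact .opp h₁ fun y hy => ih y hy (by omega)

/-- The strategy that moves to a successor in the earliest possible stage of the attractor is
winning on the attractor. -/
theorem Attr.player1Wins {k : ℕ} {x : X} (h : G.Attr k x) : G.Player1Wins x := by
  classical
  have hchoice : ∀ x, ∃ y, (x ∈ G.V₁ → (∃ y, G.edge x y) → G.edge x y) ∧
      ∀ k y', G.edge x y' → G.Attr k y' → G.edge x y ∧ G.Attr k y := by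
    intro x
    by_cases hx : ∃ k y, G.edge x y ∧ G.Attr k y
    · obtain ⟨y, hy, hk⟩ := Nat.find_spec hx
      exact ⟨y, fun _ _ => hy, fun k y' hy' hk' =>
        ⟨hy, hk.mono (Nat.find_min' hx ⟨y', hy', hk'⟩)⟩⟩
    · by_cases hs : ∃ y, G.edge x y
      · obtain ⟨y, hy⟩ := hs
        exact ⟨y, fun _ _ => hy, fun k y' hy' hk' => absurd ⟨k, y', hy', hk'⟩ hx⟩
      · exact ⟨x, fun _ h => absurd h hs, fun k y' hy' hk' => absurd ⟨k, y', hy', hk'⟩ hx⟩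
  choose f hlegal hf using hchoice
  refine ⟨⟨fun _ x => f x, fun _ x => hlegal x⟩, fun π hπ => ?_⟩
  have key : ∀ k j : ℕ, (j : ℕ∞) ≤ π.len → G.Attr k (π.pos j) → π.WonByPlayer1 := by
    intro k
    induction k with
    | zero =>
      intro j hj hk
      cases hk with
      | target h => exact .inl ⟨j, hj, h⟩
    | succ k ih =>
      intro j hj hk
      have hle : (j : ℕ∞) < π.len → ((j + 1 : ℕ) : ℕ∞) ≤ π.len := fun h => by
        push_cast
        exact Order.add_one_le_of_lt h
      cases hk with
      | target h => exact .inl ⟨j, hj, h⟩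
      | own h₁ h₂ h₃ =>
        have hlt : (j : ℕ∞) < π.len := lt_of_le_of_ne hj fun he => π.maximal j he _ h₂
        exact ih (j + 1) (hle hlt) ((hπ j hlt h₁).symm ▸ (hf _ _ _ h₂ h₃).2)
      | opp h₁ h₂ =>
        rcases hj.lt_or_eq with hlt | he
        · exact ih (j + 1) (hle hlt) (h₂ _ (π.step j hlt))
        · exact .inr ⟨j, he, h₁⟩
  exact key k 0 (by simp) (π.start.symm ▸ h)

/-- A set of positions that contains the targets, the positions of Player 1 with a successor in the
set, and the positions of Player 2 with all successors in the set, contains all positions from which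
Player 1 wins: elsewhere, Player 2 can always stay outside of the set. -/
theorem Player1Wins.mem {S : Set X} {x : X} (h : G.Player1Wins x)
    (htarget : ∀ x ∈ G.target, x ∈ S) (hown : ∀ x ∈ G.V₁, ∀ y, G.edge x y → y ∈ S → x ∈ S)
    (hopp : ∀ x ∉ G.V₁, (∀ y, G.edge x y → y ∈ S) → x ∈ S) : x ∈ S := by
  classical
  obtain ⟨σ, hσ⟩ := h
  by_contra hx
  have hchoice : ∀ x, ∃ y, x ∉ G.V₁ → x ∉ S → G.edge x y ∧ y ∉ S := by
    intro x
    by_cases hx : x ∉ G.V₁ ∧ x ∉ S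
    · have := mt (hopp x hx.1) hx.2
      push Not at this
      obtain ⟨y, hy⟩ := this
      exact ⟨y, fun _ _ => hy⟩
    · exact ⟨x, fun h₁ h₂ => absurd ⟨h₁, h₂⟩ hx⟩
  choose g hg using hchoice
  let next : List X → X → X := fun h x => if x ∈ G.V₁ then σ.move h x else g x
  let st : ℕ → List X × X := fun k =>
    Nat.rec ([], x) (fun _ p => (p.1 ++ [p.2], next p.1 p.2)) k
  let pos : ℕ → X := fun k => (st k).2
  have hhist : ∀ k, (st k).1 = (List.range k).map pos := by
    intro k
    induction k with
    | zero => rfl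
    | succ k ih =>
      rw [List.range_succ, List.map_append, ← ih]
      rfl
  have hpos : ∀ k, pos (k + 1) = next ((List.range k).map pos) (pos k) := by
    intro k
    rw [← hhist]
  let stuck : ℕ → Prop := fun k => ∀ y, ¬ G.edge (pos k) y
  let len : ℕ∞ := if h : ∃ k, stuck k then (Nat.find h : ℕ∞) else ⊤
  have hlen : ∀ k : ℕ, (k : ℕ∞) < len → ¬ stuck k := by
    intro k hk hs
    have hex : ∃ k, stuck k := ⟨k, hs⟩
    simp only [len, dif_pos hex, Nat.cast_lt] at hk
    exact Nat.find_min hex hk hs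
  have hend : ∀ k : ℕ, (k : ℕ∞) = len → stuck k := by
    intro k hk
    by_cases hex : ∃ k, stuck k
    · simp only [len, dif_pos hex, Nat.cast_inj] at hk
      rw [hk]
      exact Nat.find_spec hex
    · simp only [len, dif_neg hex] at hk
      exact absurd hk (ENat.natCast_ne_top k)
  have hstep : ∀ k : ℕ, (k : ℕ∞) < len → pos k ∉ S →
      G.edge (pos k) (pos (k + 1)) ∧ pos (k + 1) ∉ S := by
    intro k hk hS
    have hs : ∃ y, G.edge (pos k) y := by
      have := hlen k hk
      simpa only [stuck, not_forall, not_not] using this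
    rw [hpos]
    by_cases h₁ : pos k ∈ G.V₁
    · simp only [next, if_pos h₁]
      have he := σ.legal ((List.range k).map pos) (pos k) h₁ hs
      exact ⟨he, fun h => hS (hown _ h₁ _ he h)⟩
    · simp only [next, if_neg h₁]
      exact hg _ h₁ hS
  have hout : ∀ k : ℕ, (k : ℕ∞) ≤ len → pos k ∉ S := by
    intro k
    induction k with
    | zero => exact fun _ => hx
    | succ k ih =>
      intro hk
      have hlt : (k : ℕ∞) < len := lt_of_lt_of_le (by exact_mod_cast Nat.lt_succ_self k) hk
      exact (hstep k hlt (ih hlt.le)).2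
  let π : G.Play x :=
    { len := len, pos := pos, start := rfl
      step := fun k hk => (hstep k hk (hout k hk.le)).1
      maximal := hend }
  have hcons : π.Consistent σ := by
    intro k _ h₁
    exact (hpos k).trans (if_pos h₁)
  rcases hσ π hcons with ⟨k, hk, ht⟩ | ⟨k, hk, h₁⟩
  · exact hout k hk (htarget _ ht)
  · exact hout k hk.le (hopp _ h₁ fun y hy => absurd hy (hend k hk y))

end ReachGame

/-! ### Value iteration on temporal games -/

section Iteration

variable {V : Type} (A : V → V → Set ℕ) (mx tgt : Set V) (d : Prop)

open Classical in
/-- One round of value iteration, for sets of pairs of a vertex and a time instead of values. The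
owners of the vertices in `mx` try to enter the set of pairs, and the other player tries to avoid
it. -/
def stepSet (W : V → ℕ → Prop) (v : V) (i : ℕ) : Prop :=
  if v ∈ tgt then d
  else if v ∈ mx then ∃ w, i ∈ A v w ∧ W w (i + 1) else ∀ w, i ∈ A v w → W w (i + 1)

/-- The sets of pairs of a vertex and a time that are closed under decreasing the time. -/
def Down (W : V → ℕ → Prop) : Prop := ∀ v i j, i ≤ j → W v j → W v i

variable {A mx tgt d}

theorem stepSet_mono {W W' : V → ℕ → Prop} (h : ∀ v i, W v i → W' v i) (v : V) (i : ℕ)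
    (hv : stepSet A mx tgt d W v i) : stepSet A mx tgt d W' v i := by
  unfold stepSet at hv ⊢
  split_ifs at hv ⊢
  · exact hv
  · obtain ⟨w, hw, hW⟩ := hv
    exact ⟨w, hw, h _ _ hW⟩
  · exact fun w hw => h _ _ (hv w hw)

theorem Down.stepSet (hdec : ∀ v ∈ mx, ∀ w i j, i ≤ j → j ∈ A v w → i ∈ A v w)
    (hinc : ∀ v ∉ mx, ∀ w i j, i ≤ j → i ∈ A v w → j ∈ A v w) {W : V → ℕ → Prop} (h : Down W) :
    Down (stepSet A mx tgt d W) := by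
  intro v i j hij hv
  unfold TemporalGames.stepSet at hv ⊢
  split_ifs at hv ⊢ with _ hm
  · exact hv
  · obtain ⟨w, hw, hW⟩ := hv
    exact ⟨w, hdec v hm w i j hij hw, h _ _ _ (by omega) hW⟩
  · exact fun w hw => h _ _ _ (by omega) (hv w (hinc v hm w i j hij hw))

theorem Down.iterate {Φ : (V → ℕ → Prop) → V → ℕ → Prop} (hΦ : ∀ W, Down W → Down (Φ W))
    {W : V → ℕ → Prop} (h : Down W) (k : ℕ) : Down (Φ^[k] W) := by
  induction k with
  | zero => exact h
  | succ k ih =>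
    rw [Function.iterate_succ_apply']
    exact hΦ _ ih

theorem iterate_stepSet_le_succ {W : V → ℕ → Prop}
    (h : ∀ v i, W v i → stepSet A mx tgt d W v i) (k : ℕ) (v : V) (i : ℕ)
    (hv : (stepSet A mx tgt d)^[k] W v i) : (stepSet A mx tgt d)^[k + 1] W v i := by
  induction k generalizing v i with
  | zero => exact h v i hv
  | succ k ih =>
    rw [Function.iterate_succ_apply'] at hv ⊢
    exact stepSet_mono ih v i hv

/-- Increasing value iteration becomes stationary after `|V|` rounds. A pair `(v, i)` that enters in
round `k + 1` does so because of a pair `(w, i + 1)` that enters in round `k`, and so on; the vertices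
on such a chain are distinct, since all sets are closed under decreasing the time. -/
theorem iterate_stepSet_stationary [Fintype V]
    (hdec : ∀ v ∈ mx, ∀ w i j, i ≤ j → j ∈ A v w → i ∈ A v w)
    (hinc : ∀ v ∉ mx, ∀ w i j, i ≤ j → i ∈ A v w → j ∈ A v w) {W : V → ℕ → Prop} (hW : Down W)
    (h : ∀ v i, W v i → stepSet A mx tgt d W v i) {k : ℕ} (hk : Fintype.card V ≤ k) (v : V) (i : ℕ)
    (hv : (stepSet A mx tgt d)^[k + 1] W v i) : (stepSet A mx tgt d)^[k] W v i := by
  classical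
  set Wk : ℕ → V → ℕ → Prop := fun k => (stepSet A mx tgt d)^[k] W with hWk
  have hsucc : ∀ k, Wk (k + 1) = stepSet A mx tgt d (Wk k) := fun k =>
    Function.iterate_succ_apply' _ _ _
  have hmono : ∀ k v i, Wk k v i → Wk (k + 1) v i := iterate_stepSet_le_succ h
  have hdown : ∀ k, Down (Wk k) := Down.iterate (fun _ => Down.stepSet hdec hinc) hW
  have key : ∀ k v i, Wk (k + 1) v i → ¬ Wk k v i →
      ∃ S : Finset V, k + 1 ≤ S.card ∧ ∀ u ∈ S, ∃ j ≥ i, Wk (k + 1) u j := by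
    intro k
    induction k with
    | zero =>
      intro v i hv _
      exact ⟨{v}, by simp, fun u hu => ⟨i, le_rfl, by rwa [Finset.mem_singleton.1 hu]⟩⟩
    | succ k ih =>
      intro v i hv hn
      have hw : ∃ w, Wk (k + 1) w (i + 1) ∧ ¬ Wk k w (i + 1) := by
        have hv' := hv
        have hn' := hn
        rw [hsucc] at hv' hn'
        unfold stepSet at hv' hn'
        split_ifs at hv' hn' with h₁ h₂
        · exact absurd hv' hn'
        · obtain ⟨w, hw, hW⟩ := hv'
          exact ⟨w, hW, fun h' => hn' ⟨w, hw, h'⟩⟩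
        · push Not at hn'
          obtain ⟨w, hw, hW⟩ := hn'
          exact ⟨w, hv' w hw, hW⟩
      obtain ⟨w, hw₁, hw₂⟩ := hw
      obtain ⟨S, hS, hSW⟩ := ih w (i + 1) hw₁ hw₂
      have hvS : v ∉ S := by
        intro hvS
        obtain ⟨j, hj, hWj⟩ := hSW v hvS
        exact hn (hdown _ v i j (by omega) hWj)
      refine ⟨insert v S, by rw [Finset.card_insert_of_notMem hvS]; omega, fun u hu => ?_⟩
      rcases Finset.mem_insert.1 hu with rfl | hu
      · exact ⟨i, le_rfl, hv⟩
      · obtain ⟨j, hj, hWj⟩ := hSW u hu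
        exact ⟨j, by omega, hmono _ _ _ hWj⟩
  by_contra hn
  obtain ⟨S, hS, -⟩ := key k v i hv hn
  have := S.card_le_univ
  omega

/-- The vertices that stay in the set forever are determined, one round later, by the edges
that are available forever. -/
theorem forall_stepSet_iff [Finite V]
    (hdec : ∀ v ∈ mx, ∀ w i j, i ≤ j → j ∈ A v w → i ∈ A v w)
    (hinc : ∀ v ∉ mx, ∀ w i j, i ≤ j → i ∈ A v w → j ∈ A v w) {W : V → ℕ → Prop} (hW : Down W)
    (v : V) :
    (∀ i, stepSet A mx tgt d W v i) ↔ ∀ i, stepSet A mx tgt d (fun w _ => ∀ j, W w j) v i := by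
  refine ⟨fun h i => ?_, fun h i => stepSet_mono (fun w j hw => hw j) v i (h i)⟩
  unfold stepSet at h ⊢
  split_ifs at h ⊢ with h₁ h₂
  · exact h 0
  · choose f hf using h
    obtain ⟨w, hw⟩ := Finite.exists_infinite_fiber f
    have hinf := Set.infinite_coe_iff.1 hw
    refine ⟨w, ?_, fun j => ?_⟩
    · obtain ⟨k, hk, hik⟩ := hinf.exists_gt i
      have hk' : f k = w := hk
      exact hdec v h₂ w i k hik.le (hk' ▸ (hf k).1)
    · obtain ⟨k, hk, hjk⟩ := hinf.exists_gt j
      have hk' : f k = w := hk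
      exact hW w j (k + 1) (by omega) (hk' ▸ (hf k).2)
  · intro w hw j
    have := h (max i j) w (hinc v h₂ w i _ (le_max_left _ _) hw)
    exact hW w j _ (by omega) this

/-- A decreasing sequence of subsets of a finite type in which each set determines the next one is
stationary from the index `|V|` on. -/
theorem antitone_stationary [Fintype V] {Z : ℕ → Set V} (hZ : ∀ k, Z (k + 1) ⊆ Z k)
    (hdet : ∀ k, Z k = Z (k + 1) → Z (k + 1) = Z (k + 2)) {k : ℕ} (hk : Fintype.card V ≤ k) :
    Z k = Z (k + 1) := by
  by_contra hne
  have hne' : ∀ j ≤ k, Z j ≠ Z (j + 1) := by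
    intro j hj he
    have : ∀ l, Z (j + l) = Z (j + l + 1) := by
      intro l
      induction l with
      | zero => exact he
      | succ l ih => exact hdet _ ih
    have := this (k - j)
    rw [Nat.add_sub_cancel' hj] at this
    exact hne this
  have hcard : ∀ j ≤ k + 1, (Z j).ncard + j ≤ Fintype.card V := by
    intro j
    induction j with
    | zero =>
      intro _
      have := Set.ncard_le_card (Z 0)
      simpa [Nat.card_eq_fintype_card] using this
    | succ j ih =>
      intro hj
      have h₁ := ih (by omega)
      have h₂ := Set.ncard_lt_ncard ((hZ j).ssubset_of_ne (hne' j (by omega)).symm)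
      omega
  have := hcard (k + 1) le_rfl
  omega

end Iteration

/-! ### Correctness of the decision procedure -/

namespace Constraint

theorem isBad_true_iff (c : Constraint) :
    c.isBad true = false ↔ ∀ i, i + 1 ∈ c.times → i ∈ c.times := by
  rcases c with c | c
  · simp only [isBad, times, Set.mem_ofPred_eq, true_iff]
    intro i hi
    omega
  · simp only [isBad, times, Set.mem_ofPred_eq, decide_eq_false_iff_not, not_not]
    constructor
    · rintro rfl i _
      exact Nat.zero_le i
    · intro h
      by_contra hc
      have := h (c - 1) (by omega)
      omega

theorem isBad_false_iff (c : Constraint) :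
    c.isBad false = false ↔ ∀ i, i ∈ c.times → i + 1 ∈ c.times := by
  rcases c with c | c
  · simp only [isBad, times, Set.mem_ofPred_eq, Bool.true_eq_false, false_iff]
    intro h
    have := h c le_rfl
    omega
  · simp only [isBad, times, Set.mem_ofPred_eq, true_iff]
    intro i hi
    omega

theorem lt_bound_true_iff {c : Constraint} (hc : c.isBad true = false) (i : ℕ) :
    (i : ℕ∞) < (c.bound true).toENat ↔ i ∈ c.times := by
  rcases c with c | c
  · simp only [bound, Value.toENat, num_inc, num_encodeNat, times, Nat.cast_lt, Set.mem_ofPred_eq]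
    omega
  · simp only [isBad, decide_eq_false_iff_not, not_not] at hc
    subst hc
    simp [bound, Value.toENat, times]

theorem lt_bound_false_iff {c : Constraint} (hc : c.isBad false = false) (i : ℕ) :
    (i : ℕ∞) < (c.bound false).toENat ↔ i ∉ c.times := by
  rcases c with c | c
  · simp [isBad] at hc
  · simp [bound, Value.toENat, num_encodeNat, times]

end Constraint

theorem lt_accumulate_true_iff (w a : Value) (c : Constraint) (i : ℕ) :
    (i : ℕ∞) < (accumulate true w.pred a (some c)).toENat ↔
      (i : ℕ∞) < a.toENat ∨
        (i : ℕ∞) < (c.bound true).toENat ∧ ((i + 1 : ℕ) : ℕ∞) < w.toENat := by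
  simp only [accumulate, Value.toENat_select_true, Bool.not_true, Value.toENat_select_false,
    lt_max_iff, lt_min_iff, Value.lt_toENat_pred]
  tauto

theorem lt_accumulate_false_iff (w a : Value) (c : Constraint) (i : ℕ) :
    (i : ℕ∞) < (accumulate false w.pred a (some c)).toENat ↔
      (i : ℕ∞) < a.toENat ∧
        (¬ (i : ℕ∞) < (c.bound false).toENat → ((i + 1 : ℕ) : ℕ∞) < w.toENat) := by
  simp only [accumulate, Value.toENat_select_true, Bool.not_false, Value.toENat_select_false,
    lt_max_iff, lt_min_iff, Value.lt_toENat_pred]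
  tauto

theorem lt_rowValue_true_iff {α : Type} (e : α → Option Constraint) (T : α → Value) (l : List α)
    (i : ℕ) : (i : ℕ∞) < (rowValue true e T l).toENat ↔
      ∃ w ∈ l, ∃ c, e w = some c ∧ (i : ℕ∞) < (c.bound true).toENat ∧
        ((i + 1 : ℕ) : ℕ∞) < (T w).toENat := by
  induction l using List.reverseRecOn with
  | nil => simp [rowValue, Value.start, Value.toENat, num]
  | append_singleton l w ih =>
    simp only [rowValue, List.foldl_append, List.foldl_cons, List.foldl_nil, List.mem_append,
      List.mem_singleton, or_and_right, exists_or, exists_eq_left] at ih ⊢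
    rcases h : e w with _ | c
    · simpa [accumulate] using ih
    · simp only [lt_accumulate_true_iff, Option.some.injEq, exists_eq_left', ih]

theorem lt_rowValue_false_iff {α : Type} (e : α → Option Constraint) (T : α → Value) (l : List α)
    (i : ℕ) : (i : ℕ∞) < (rowValue false e T l).toENat ↔
      ∀ w ∈ l, ∀ c, e w = some c → ¬ (i : ℕ∞) < (c.bound false).toENat →
        ((i + 1 : ℕ) : ℕ∞) < (T w).toENat := by
  induction l using List.reverseRecOn with
  | nil => simp [rowValue, Value.start, Value.toENat]
  | append_singleton l w ih =>
    simp only [rowValue, List.foldl_append, List.foldl_cons, List.foldl_nil, List.mem_append,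
      List.mem_singleton, or_imp, forall_and, forall_eq] at ih ⊢
    rcases h : e w with _ | c
    · simpa [accumulate] using ih
    · simp only [lt_accumulate_false_iff, Option.some.injEq, forall_eq', ih]

namespace Instance

variable (I : Instance)

/-- The pairs of a vertex and a time below the value of the vertex. -/
def below {V : Type} (T : V → Value) (v : V) (i : ℕ) : Prop := (i : ℕ∞) < (T v).toENat

theorem down_below {V : Type} (T : V → Value) : Down (below T) := fun _ _ _ hij hj =>
  lt_of_le_of_lt (by exact_mod_cast hij) hj

theorem isBad_eq_false_iff (imp : Bool) : I.isBad imp = false ↔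
    ∀ v w c, I.edge v w = some c → c.isBad (I.maximizes imp v) = false := by
  simp only [isBad, List.any_eq_false, List.mem_finRange, true_imp_iff, Function.comp_apply,
    Bool.not_eq_true]
  refine forall_congr' fun v => forall_congr' fun w => ?_
  rcases I.edge v w with _ | c <;> simp [badEntry]

/-- The vertices of the player who aims at large values. -/
def maxSet (imp : Bool) : Set (Fin I.n) := {v | I.maximizes imp v = true}

variable {I}

theorem maxSet_decreasing {imp : Bool} (h : I.isBad imp = false) :
    ∀ v ∈ I.maxSet imp, ∀ w i j, i ≤ j → j ∈ I.game.avail v w → i ∈ I.game.avail v w := by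
  rintro v hv w i j hij ⟨c, hc, hj⟩
  have hb := (I.isBad_eq_false_iff imp).1 h v w c hc
  rw [show I.maximizes imp v = true from hv, Constraint.isBad_true_iff] at hb
  refine ⟨c, hc, ?_⟩
  induction hij with
  | refl => exact hj
  | step _ ih => exact ih (hb _ hj)

theorem maxSet_compl_increasing {imp : Bool} (h : I.isBad imp = false) :
    ∀ v ∉ I.maxSet imp, ∀ w i j, i ≤ j → i ∈ I.game.avail v w → j ∈ I.game.avail v w := by
  rintro v hv w i j hij ⟨c, hc, hi⟩
  have hb := (I.isBad_eq_false_iff imp).1 h v w c hc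
  rw [Bool.eq_false_iff.2 hv, Constraint.isBad_false_iff] at hb
  refine ⟨c, hc, ?_⟩
  induction hij with
  | refl => exact hi
  | step _ ih => exact hb _ ih

/-- A round of the decision procedure computes the values that describe the next set. -/
theorem below_next {imp : Bool} (h : I.isBad imp = false) (T : Fin I.n → Value) :
    below (I.next imp T) =
      stepSet I.game.avail (I.maxSet imp) I.game.target (imp = false) (below T) := by
  funext v i
  have hb := (I.isBad_eq_false_iff imp).1 h v
  have htgt : v ∈ I.game.target ↔ I.isTarget v = true := Iff.rfl
  have hmem : v ∈ I.maxSet imp ↔ I.maximizes imp v = true := Iff.rfl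
  simp only [below, next, stepSet, htgt, hmem]
  split_ifs with h₁ h₂
  · cases imp <;> simp [Value.start, Value.toENat, num]
  · rw [h₂] at hb ⊢
    rw [lt_rowValue_true_iff]
    refine propext ⟨?_, ?_⟩
    · rintro ⟨w, -, c, hc, hi, hw⟩
      exact ⟨w, ⟨c, hc, (Constraint.lt_bound_true_iff (hb w c hc) i).1 hi⟩, hw⟩
    · rintro ⟨w, ⟨c, hc, hi⟩, hw⟩
      exact ⟨w, List.mem_finRange w, c, hc, (Constraint.lt_bound_true_iff (hb w c hc) i).2 hi, hw⟩
  · rw [Bool.eq_false_iff.2 h₂] at hb ⊢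
    rw [lt_rowValue_false_iff]
    refine propext ⟨?_, ?_⟩
    · rintro hall w ⟨c, hc, hi⟩
      exact hall w (List.mem_finRange w) c hc
        fun hn => (Constraint.lt_bound_false_iff (hb w c hc) i).1 hn hi
    · rintro hall w - c hc hi
      refine hall w ⟨c, hc, ?_⟩
      by_contra hn
      exact hi ((Constraint.lt_bound_false_iff (hb w c hc) i).2 hn)

theorem below_iterate_next {imp : Bool} (h : I.isBad imp = false) (T : Fin I.n → Value) (k : ℕ) :
    below ((I.next imp)^[k] T) =
      (stepSet I.game.avail (I.maxSet imp) I.game.target (imp = false))^[k] (below T) := by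
  induction k with
  | zero => rfl
  | succ k ih => rw [Function.iterate_succ_apply', Function.iterate_succ_apply', below_next h, ih]

theorem below_collapse {V : Type} (T : V → Value) :
    below (fun w => (T w).collapse) = fun v _ => ∀ j, below T v j := by
  funext v i
  unfold below
  rcases h : T v with _ | l
  · simp [h, Value.collapse, Value.toENat]
  · simp only [h, Value.collapse, Value.toENat, num, Nat.cast_zero, not_lt_zero, Nat.cast_lt,
      eq_iff_iff, false_iff]
    exact fun hall => lt_irrefl _ (hall (num l))

theorem decreasingEdge_iff (u v : Fin I.n) : I.game.DecreasingEdge u v ↔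
    ∀ c, I.edge u v = some c → c.isBad true = false := by
  simp only [Constraint.isBad_true_iff]
  constructor
  · intro h c hc i hi
    obtain ⟨c', hc', hi'⟩ := h i ⟨c, hc, hi⟩
    obtain rfl : c = c' := Option.some.inj (hc.symm.trans hc')
    exact hi'
  · rintro h i ⟨c, hc, hi⟩
    exact ⟨c, hc, h c hc i hi⟩

theorem increasingEdge_iff (u v : Fin I.n) : I.game.IncreasingEdge u v ↔
    ∀ c, I.edge u v = some c → c.isBad false = false := by
  simp only [Constraint.isBad_false_iff]
  constructor
  · intro h c hc i hi
    obtain ⟨c', hc', hi'⟩ := h i ⟨c, hc, hi⟩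
    obtain rfl : c = c' := Option.some.inj (hc.symm.trans hc')
    exact hi'
  · rintro h i ⟨c, hc, hi⟩
    exact ⟨c, hc, h c hc i hi⟩

theorem isBad_false_eq_false_iff : I.isBad false = false ↔ I.game.Declining := by
  rw [isBad_eq_false_iff]
  simp only [TemporalGame.Declining, decreasingEdge_iff, increasingEdge_iff, maximizes,
    Bool.xor_false]
  have hV : ∀ u, u ∈ I.game.V₁ ↔ I.ownedBy1 u = true := fun _ => Iff.rfl
  constructor
  · intro h
    refine ⟨fun u hu v c hc => ?_, fun u hu v c hc => ?_⟩
    · simpa [(hV u).1 hu] using h u v c hc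
    · simpa [Bool.eq_false_iff.2 (mt (hV u).2 hu)] using h u v c hc
  · rintro ⟨h₁, h₂⟩ u v c hc
    by_cases hu : I.ownedBy1 u = true
    · rw [hu]
      exact h₁ u hu v c hc
    · rw [Bool.eq_false_iff.2 hu]
      exact h₂ u hu v c hc

theorem isBad_true_eq_false_iff : I.isBad true = false ↔ I.game.Improving := by
  rw [isBad_eq_false_iff]
  simp only [TemporalGame.Improving, decreasingEdge_iff, increasingEdge_iff, maximizes,
    Bool.xor_true]
  have hV : ∀ u, u ∈ I.game.V₁ ↔ I.ownedBy1 u = true := fun _ => Iff.rfl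
  constructor
  · intro h
    refine ⟨fun u hu v c hc => ?_, fun u hu v c hc => ?_⟩
    · simpa [(hV u).1 hu] using h u v c hc
    · simpa [Bool.eq_false_iff.2 (mt (hV u).2 hu)] using h u v c hc
  · rintro ⟨h₁, h₂⟩ u v c hc
    by_cases hu : I.ownedBy1 u = true
    · rw [hu]
      exact h₁ u hu v c hc
    · rw [Bool.eq_false_iff.2 hu]
      exact h₂ u hu v c hc

/-- In a declining game, Player 1 wins from a vertex exactly at the times below its value: the sets
of value iteration are stages of the attractor, and the last of them is closed. -/
theorem player1Wins_iff_of_declining (h : I.isBad false = false) :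
    I.game.Player1Wins I.init ↔ below I.decliningTable I.init 0 := by
  have hdec := maxSet_decreasing h
  have hinc := maxSet_compl_increasing h
  have hmax : ∀ v, v ∈ I.maxSet false ↔ v ∈ I.game.V₁ := fun v => by simp [maxSet, maximizes, game]
  set Φ := stepSet I.game.avail (I.maxSet false) I.game.target (false = false) with hΦ
  set W : ℕ → Fin I.n → ℕ → Prop := fun k => Φ^[k] (below fun _ => Value.start true) with hWdef
  have hsucc : ∀ k, W (k + 1) = Φ (W k) := fun k => Function.iterate_succ_apply' _ _ _
  have hzero : ∀ v i, ¬ W 0 v i := by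
    intro v i
    simp [hWdef, below, Value.start, Value.toENat, num]
  have hT : below I.decliningTable = W I.encode.length := below_iterate_next h _ _
  rw [hT]
  constructor
  · intro hwin
    have hfix : ∀ v i, Φ (W I.encode.length) v i → W I.encode.length v i := by
      intro v i hv
      rw [← hsucc] at hv
      exact iterate_stepSet_stationary hdec hinc (down_below _)
        (fun v i hv => absurd hv (hzero v i)) (by simpa using length_le_length_encode I) v i hv
    refine hwin.mem (S := {p | W I.encode.length p.1 p.2}) ?_ ?_ ?_
    · rintro ⟨v, i⟩ hv
      have hv' : v ∈ I.game.target := hv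
      refine hfix v i ?_
      simp [hΦ, stepSet, hv']
    · rintro ⟨v, i⟩ hv ⟨w, j⟩ ⟨hj, ha⟩ hw
      refine hfix v i ?_
      have hv' : v ∈ I.maxSet false := (hmax v).2 hv
      simp only at hj ha
      subst hj
      simp only [hΦ, stepSet, if_pos hv']
      split_ifs
      · exact ⟨w, ha, hw⟩
    · rintro ⟨v, i⟩ hv hall
      refine hfix v i ?_
      have hv' : v ∉ I.maxSet false := fun hm => hv ((hmax v).1 hm)
      simp only [hΦ, stepSet, if_neg hv']
      split_ifs
      · exact fun w hw => hall (w, i + 1) ⟨rfl, hw⟩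
  · have key : ∀ k v i, W k v i → I.game.expansion.Attr k (v, i) := by
      intro k
      induction k with
      | zero => exact fun v i hv => absurd hv (hzero v i)
      | succ k ih =>
        intro v i hv
        rw [hsucc] at hv
        simp only [hΦ, stepSet] at hv
        split_ifs at hv with h₁ h₂
        · exact .target h₁
        · obtain ⟨w, hw, hW⟩ := hv
          exact .own ((hmax v).1 h₂) ⟨rfl, hw⟩ (ih w (i + 1) hW)
        · refine .opp (fun hm => h₂ ((hmax v).2 hm)) ?_
          rintro ⟨w, j⟩ ⟨hj, ha⟩
          simp only at hj ha
          subst hj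
          exact ih w (i + 1) (hv w ha)
    exact fun hv => (key _ _ _ hv).player1Wins

/-- In an improving game, Player 1 wins from a vertex exactly at the times that are not below its
value. The first phase determines the vertices with infinite value, from which Player 2 wins at all
times; all other vertices are won by Player 1 at late times. Starting from the former, the second
phase increases the values until they describe a closed set, and by a backward induction on the time,
everything outside belongs to the attractor. -/
theorem player1Wins_iff_of_improving (h : I.isBad true = false) :
    I.game.Player1Wins I.init ↔ ¬ below I.improvingTable I.init 0 := by
  have hdec := maxSet_decreasing h
  have hinc := maxSet_compl_increasing h
  have hmax : ∀ v, v ∈ I.maxSet true ↔ v ∉ I.game.V₁ := fun v => by simp [maxSet, maximizes, game]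
  have hcard : Fintype.card (Fin I.n) ≤ I.encode.length := by simpa using length_le_length_encode I
  set N := I.encode.length with hN
  set Φ := stepSet I.game.avail (I.maxSet true) I.game.target (true = false) with hΦ
  have hdown : ∀ W, Down W → Down (Φ W) := fun W => Down.stepSet hdec hinc
  set P : ℕ → Fin I.n → ℕ → Prop := fun k => Φ^[k] (below fun _ => Value.start false) with hP
  set Q : ℕ → Fin I.n → ℕ → Prop := fun k => Φ^[k] (fun v _ => ∀ j, P N v j) with hQ
  have hPsucc : ∀ k, P (k + 1) = Φ (P k) := fun k => Function.iterate_succ_apply' _ _ _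
  have hQsucc : ∀ k, Q (k + 1) = Φ (Q k) := fun k => Function.iterate_succ_apply' _ _ _
  have hPdown : ∀ k, Down (P k) := Down.iterate hdown (down_below _)
  have hPzero : ∀ v i, P 0 v i := fun v i => by simp [hP, below, Value.start, Value.toENat]
  have hT : below I.improvingTable = Q N := by
    refine (below_iterate_next h _ _).trans (congrArg _ ((below_collapse _).trans ?_))
    rw [below_iterate_next h]
  -- The set of vertices with infinite value is stationary.
  have hZstep : ∀ k v, (∀ i, P (k + 1) v i) ↔ ∀ i, Φ (fun w _ => ∀ j, P k w j) v i := by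
    intro k v
    rw [hPsucc]
    exact forall_stepSet_iff hdec hinc (hPdown k) v
  have hPanti : ∀ k v i, P (k + 1) v i → P k v i := by
    intro k
    induction k with
    | zero => exact fun v i _ => hPzero v i
    | succ k ih =>
      intro v i hv
      rw [hPsucc] at hv ⊢
      exact stepSet_mono ih v i hv
  have hZ : {v | ∀ i, P N v i} = {v | ∀ i, P (N + 1) v i} := by
    refine antitone_stationary (Z := fun k => {v | ∀ i, P k v i})
      (fun k v hv i => hPanti k v i (hv i)) (fun k hk => ?_) hcard
    ext v
    have hk' : ∀ w, (∀ j, P k w j) = ∀ j, P (k + 1) w j := fun w => propext (Set.ext_iff.1 hk w)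
    simp only [Set.mem_ofPred_eq]
    rw [hZstep k, hZstep (k + 1)]
    simp only [hk']
  have hQ₀ : ∀ v i, Q 0 v i → Φ (Q 0) v i := by
    intro v i hv
    have hv' : ∀ i, P (N + 1) v i := (Set.ext_iff.1 hZ v).1 hv
    exact (hZstep N v).1 hv' i
  have hQmono : ∀ k v i, Q k v i → Q (k + 1) v i := iterate_stepSet_le_succ hQ₀
  have hQle : ∀ k v i, Q 0 v i → Q k v i := by
    intro k
    induction k with
    | zero => exact fun _ _ hv => hv
    | succ k ih => exact fun v i hv => hQmono k v i (ih v i hv)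
  have hfix : Φ (Q N) = Q N := by
    funext v i
    refine propext ⟨fun hv => ?_, fun hv => ?_⟩
    · rw [← hQsucc] at hv
      exact iterate_stepSet_stationary hdec hinc (fun _ _ _ _ hv => hv) hQ₀ hcard v i hv
    · rw [← hQsucc]
      exact hQmono N v i hv
  rw [hT]
  constructor
  · intro hwin
    refine hwin.mem (S := {p | ¬ Q N p.1 p.2}) ?_ ?_ ?_
    · rintro ⟨v, i⟩ hv
      have hv' : v ∈ I.game.target := hv
      simp only [Set.mem_ofPred_eq]
      rw [← hfix]
      simp [hΦ, stepSet, hv']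
    · rintro ⟨v, i⟩ hv ⟨w, j⟩ ⟨hj, ha⟩ hw
      have hv' : v ∉ I.maxSet true := fun hm => (hmax v).1 hm hv
      simp only at hj ha
      subst hj
      simp only [Set.mem_ofPred_eq] at hw ⊢
      rw [← hfix]
      simp only [hΦ, stepSet, if_neg hv']
      split_ifs
      · simp
      · exact fun hall => hw (hall w ha)
    · rintro ⟨v, i⟩ hv hall
      have hv' : v ∈ I.maxSet true := (hmax v).2 hv
      simp only [Set.mem_ofPred_eq]
      rw [← hfix]
      simp only [hΦ, stepSet, if_pos hv']
      split_ifs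
      · simp
      · rintro ⟨w, hw, hW⟩
        exact hall (w, i + 1) ⟨rfl, hw⟩ hW
  · have hstep : ∀ (W : Fin I.n → ℕ → Prop) k v i,
        (∀ w, ¬ W w (i + 1) → I.game.expansion.Attr k (w, i + 1)) → ¬ Φ W v i →
        I.game.expansion.Attr (k + 1) (v, i) := by
      intro W k v i hW hv
      simp only [hΦ, stepSet] at hv
      split_ifs at hv with h₁ h₂
      · exact .target h₁
      · push Not at hv
        refine .opp ((hmax v).1 h₂) ?_
        rintro ⟨w, j⟩ ⟨hj, ha⟩
        simp only at hj ha
        subst hj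
        exact hW w (hv w ha)
      · push Not at hv
        obtain ⟨w, hw, hn⟩ := hv
        have hv₁ : v ∈ I.game.V₁ := by
          by_contra hn₁
          exact h₂ ((hmax v).2 hn₁)
        exact .own hv₁ ⟨rfl, hw⟩ (hW w hn)
    have hPattr : ∀ k v i, ¬ P k v i → I.game.expansion.Attr k (v, i) := by
      intro k
      induction k with
      | zero => exact fun v i hv => absurd (hPzero v i) hv
      | succ k ih =>
        intro v i hv
        rw [hPsucc] at hv
        exact hstep _ k v i (fun w => ih w (i + 1)) hv
    -- A time from which on Player 1 wins from all vertices with finite value.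
    have hlate : ∃ M, ∀ v, ¬ Q 0 v 0 → ∀ i ≥ M, ¬ P N v i := by
      have hex : ∀ v, ∃ m, ¬ Q 0 v 0 → ¬ P N v m := by
        intro v
        by_cases hv : ∀ j, P N v j
        · exact ⟨0, fun hn => absurd hv hn⟩
        · push Not at hv
          obtain ⟨m, hm⟩ := hv
          exact ⟨m, fun _ => hm⟩
      choose m hm using hex
      refine ⟨Finset.univ.sup m, fun v hv i hi hP => hm v hv ?_⟩
      exact hPdown N v (m v) i ((Finset.le_sup (Finset.mem_univ v)).trans hi) hP
    obtain ⟨M, hM⟩ := hlate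
    have key : ∀ k v i, M ≤ i + k → ¬ Q N v i → I.game.expansion.Attr (N + k) (v, i) := by
      intro k
      induction k with
      | zero =>
        intro v i hi hv
        exact hPattr N v i (hM v (fun h0 => hv (hQle N v i h0)) i hi)
      | succ k ih =>
        intro v i hi hv
        rw [← hfix] at hv
        exact hstep _ (N + k) v i (fun w => ih w (i + 1) (by omega)) hv
    exact fun hv => (key M _ _ (by omega) hv).player1Wins

end Instance

end TemporalGames

theorem mainTheorem2 :
    TemporalGames.InP TemporalGames.Instance.encode
        (fun I => I.game.Declining ∧ I.game.Player1Wins I.init) ∧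
      TemporalGames.InP TemporalGames.Instance.encode
        (fun I => I.game.Improving ∧ I.game.Player1Wins I.init) := by
  refine ⟨TemporalGames.inP_of_finalTable _ false fun I => ?_,
    TemporalGames.inP_of_finalTable _ true fun I => ?_⟩
  · rw [← TemporalGames.Instance.isBad_false_eq_false_iff]
    refine and_congr_right fun h => ?_
    rw [TemporalGames.Instance.player1Wins_iff_of_declining h, Bool.xor_false,
      TemporalGames.Value.positive_iff]
    rfl
  · rw [← TemporalGames.Instance.isBad_true_eq_false_iff]
    refine and_congr_right fun h => ?_
    rw [TemporalGames.Instance.player1Wins_iff_of_improving h, Bool.xor_true,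
      Bool.not_eq_true', ← Bool.not_eq_true, TemporalGames.Value.positive_iff]
    rfl
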